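/- Let $d\in C^1(\mathbb{R})$ satisfy $d(0)=0$ and, for some constants $d_0>0$ and $d_1,d_2,r\ge 0$, $d'(s)>d_0$ and $|d'(s)|\le d_1+d_2|s|^r$ for all $s\in\mathbb{R}$. Let $T>0$, $\bar f,\bar g\in L^2(0,1)$, $\bar h=(\bar h(0),\bar h(1))\in\mathbb{R}^2$, and let $p_0,m_0\in H^1(0,1)$, where $p_0$ is compatible with the boundary data, i.e. $p_0(0)=\bar h(0)$ and $p_0(1)=\bar h(1)$. Then there exists a unique pair $(p,m)\in C([0,T];H^1(0,1)\times H^1(0,1))\cap C^1([0,T];L^2(0,1)\times L^2(0,1))$ which for all $t\in[0,T]$ satisfies $$\partial_t p(t)+\partial_x m(t)=\bar f,\qquad \partial_t m(t)+\partial_x p(t)+d(m(t))=\bar g\qquad\text{a.e. in }(0,1),$$ the boundary conditions $p(x,t)=\bar h(x)$ for $x\in\{0,1\}$, and the initial conditions $p(0)=p_0$, $m(0)=m_0$. -/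

import Mathlib

open MeasureTheory Set

open scoped ContDiff

noncomputable section

/-- Lebesgue measure on the open unit interval `(0,1)`. -/
abbrev unitMeasure : Measure ℝ := volume.restrict (Ioo (0 : ℝ) 1)

/-- The Hilbert space `L²(0,1)` of real-valued square-integrable functions. -/
abbrev L2 : Type := Lp ℝ 2 unitMeasure

/-- `φ` is a test function on `(0,1)`, i.e. an element of `C_c^∞(0,1)`. -/
def IsTestFunction (φ : ℝ → ℝ) : Prop :=
  ContDiff ℝ ∞ φ ∧ HasCompactSupport φ ∧ tsupport φ ⊆ Ioo 0 1

/-- `w ∈ L²(0,1)` is the weak derivative of `u ∈ L²(0,1)` on `(0,1)`. -/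
def IsWeakDeriv (u w : L2) : Prop :=
  ∀ φ : ℝ → ℝ, IsTestFunction φ →
    ∫ x in Ioo (0 : ℝ) 1, u x * deriv φ x = -∫ x in Ioo (0 : ℝ) 1, w x * φ x

lemma IsTestFunction.memLp {φ : ℝ → ℝ} (h : IsTestFunction φ) : MemLp φ 2 unitMeasure :=
  (h.1.continuous.memLp_of_hasCompactSupport h.2.1).restrict _

lemma IsTestFunction.memLp_deriv {φ : ℝ → ℝ} (h : IsTestFunction φ) :
    MemLp (deriv φ) 2 unitMeasure :=
  ((h.1.continuous_deriv (by simp)).memLp_of_hasCompactSupport h.2.1.deriv).restrict _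

lemma L2.integrable_mul (u : L2) {ψ : ℝ → ℝ} (h : MemLp ψ 2 unitMeasure) :
    Integrable (fun x => u x * ψ x) unitMeasure :=
  (Lp.memLp u).integrable_mul h

lemma L2.integral_add_mul (u v : L2) {ψ : ℝ → ℝ} (h : MemLp ψ 2 unitMeasure) :
    ∫ x in Ioo (0 : ℝ) 1, (u + v : L2) x * ψ x
      = (∫ x in Ioo (0 : ℝ) 1, u x * ψ x) + ∫ x in Ioo (0 : ℝ) 1, v x * ψ x := by
  rw [← integral_add (u.integrable_mul h) (v.integrable_mul h)]
  refine integral_congr_ae ?_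
  filter_upwards [Lp.coeFn_add u v] with x hx
  rw [hx, Pi.add_apply, add_mul]

lemma L2.integral_smul_mul (c : ℝ) (u : L2) (ψ : ℝ → ℝ) :
    ∫ x in Ioo (0 : ℝ) 1, (c • u : L2) x * ψ x = c * ∫ x in Ioo (0 : ℝ) 1, u x * ψ x := by
  rw [← integral_const_mul]
  refine integral_congr_ae ?_
  filter_upwards [Lp.coeFn_smul c u] with x hx
  rw [hx, Pi.smul_apply, smul_eq_mul, mul_assoc]

lemma L2.integral_zero_mul (ψ : ℝ → ℝ) :
    ∫ x in Ioo (0 : ℝ) 1, (0 : L2) x * ψ x = 0 := by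
  simpa using L2.integral_smul_mul 0 (0 : L2) ψ

/-- The weak derivative is unique. -/
lemma IsWeakDeriv.unique {u w₁ w₂ : L2} (h₁ : IsWeakDeriv u w₁) (h₂ : IsWeakDeriv u w₂) :
    w₁ = w₂ := by
  have hint : ∀ w : L2, LocallyIntegrableOn (w : ℝ → ℝ) (Ioo (0 : ℝ) 1) volume := fun w =>
    IntegrableOn.locallyIntegrableOn (μ := volume) ((Lp.memLp w).integrable (by norm_num))
  have key := isOpen_Ioo.ae_eq_zero_of_integral_contDiff_smul_eq_zero
    (f := fun x => w₁ x - w₂ x) ((hint w₁).sub (hint w₂)) (fun φ hφ hc hs => by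
      have ht : IsTestFunction φ := ⟨hφ, hc, hs⟩
      have e : ∫ x in Ioo (0 : ℝ) 1, w₁ x * φ x = ∫ x in Ioo (0 : ℝ) 1, w₂ x * φ x := by
        linarith [h₁ φ ht, h₂ φ ht]
      have e2 : ∫ x in Ioo (0 : ℝ) 1, φ x • (w₁ x - w₂ x) = 0 := by
        have : ∀ x, φ x • (w₁ x - w₂ x) = w₁ x * φ x - w₂ x * φ x := fun x => by
          simp only [smul_eq_mul]; ring
        simp_rw [this]
        rw [integral_sub (w₁.integrable_mul ht.memLp) (w₂.integrable_mul ht.memLp), e, sub_self]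
      rw [← e2]
      refine (setIntegral_eq_integral_of_forall_compl_eq_zero fun x hx => ?_).symm
      have : φ x = 0 := image_eq_zero_of_notMem_tsupport fun hx' => hx (hs hx')
      simp [this])
  refine Lp.ext ?_
  refine (ae_restrict_iff' measurableSet_Ioo).2 ?_
  filter_upwards [key] with x hx hm
  exact sub_eq_zero.1 (hx hm)

/-- The Sobolev space `H¹(0,1)` as a subspace of `L² ⊕ L²`, realised as the set of pairs `(u, ∂ₓu)` of an `L²` function and
its (unique) weak derivative in `L²`. The norm inherited from the Hilbert sum `L² ⊕ L²` is the
`H¹` norm `(‖u‖² + ‖∂ₓu‖²)^{1/2}`. -/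
def H1Submodule : Submodule ℝ (WithLp 2 (L2 × L2)) where
  carrier := {v | IsWeakDeriv v.fst v.snd}
  zero_mem' := fun φ _ => by
    simp only [WithLp.zero_fst, WithLp.zero_snd]
    rw [L2.integral_zero_mul, L2.integral_zero_mul, neg_zero]
  add_mem' := fun {a b} ha hb φ hφ => by
    simp only [WithLp.add_fst, WithLp.add_snd]
    rw [L2.integral_add_mul _ _ hφ.memLp_deriv, L2.integral_add_mul _ _ hφ.memLp, ha φ hφ,
      hb φ hφ, neg_add]
  smul_mem' := fun c a ha φ hφ => by
    simp only [WithLp.smul_fst, WithLp.smul_snd]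
    rw [L2.integral_smul_mul, L2.integral_smul_mul, ha φ hφ, mul_neg]

/-- The Sobolev space `H¹(0,1)` with its `H¹` norm. -/
abbrev H1 : Type := H1Submodule

/-- The embedding `H¹(0,1) → L²(0,1)`. -/
def H1.fn (u : H1) : L2 := (u : WithLp 2 (L2 × L2)).fst

/-- The weak derivative `∂ₓ : H¹(0,1) → L²(0,1)`. -/
def H1.dx (u : H1) : L2 := (u : WithLp 2 (L2 × L2)).snd

/-- `u ∈ H¹(0,1)` takes the boundary values `u(0) = h 0` and `u(1) = h 1`: these are the values
at the end points of the continuous representative of `u` on `[0,1]`. -/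
def H1.HasBoundaryValues (u : H1) (h : Fin 2 → ℝ) : Prop :=
  ∃ c : ℝ → ℝ, ContinuousOn c (Icc 0 1) ∧ c =ᵐ[unitMeasure] u.fn ∧ c 0 = h 0 ∧ c 1 = h 1

/-- The assumptions on the damping function: `d ∈ C¹(ℝ)`, `d(0) = 0`, `d'(m) > d₀` and
`|d'(m)| ≤ d₁ + d₂|m|^p` for some `d₀ > 0` and `d₁, d₂, p ≥ 0`. -/
def IsDamping (d : ℝ → ℝ) : Prop :=
  ContDiff ℝ 1 d ∧ d 0 = 0 ∧
    ∃ d₀ d₁ d₂ p : ℝ, 0 < d₀ ∧ 0 ≤ d₁ ∧ 0 ≤ d₂ ∧ 0 ≤ p ∧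
      ∀ m : ℝ, d₀ < deriv d m ∧ |deriv d m| ≤ d₁ + d₂ * |m| ^ p

/-- `(p, m)`, considered on `[0,T]`, belongs to `C([0,T]; H¹ × H¹) ∩ C¹([0,T]; L² × L²)` and solves
`∂ₜp + ∂ₓm = f`, `∂ₜm + ∂ₓp + d(m) = g` on `(0,1) × [0,T]` with `p = h` on `{0,1} × [0,T]` and
initial values `p(0) = p₀`, `m(0) = m₀`. -/
structure IsSolution (d : ℝ → ℝ) (f g : L2) (h : Fin 2 → ℝ) (p₀ m₀ : H1) (T : ℝ)
    (p m : ℝ → H1) : Prop where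
  continuousOn_p : ContinuousOn p (Icc 0 T)
  continuousOn_m : ContinuousOn m (Icc 0 T)
  contDiffOn_p : ContDiffOn ℝ 1 (fun t => (p t).fn) (Icc 0 T)
  contDiffOn_m : ContDiffOn ℝ 1 (fun t => (m t).fn) (Icc 0 T)
  eq_p : ∀ t ∈ Icc 0 T, ∀ᵐ x ∂unitMeasure,
    derivWithin (fun s => (p s).fn) (Icc 0 T) t x + (m t).dx x = f x
  eq_m : ∀ t ∈ Icc 0 T, ∀ᵐ x ∂unitMeasure,
    derivWithin (fun s => (m s).fn) (Icc 0 T) t x + (p t).dx x + d ((m t).fn x) = g x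
  boundary : ∀ t ∈ Icc 0 T, (p t).HasBoundaryValues h
  init_p : p 0 = p₀
  init_m : m 0 = m₀

end

open MeasureTheory Set
open scoped ContDiff

/-! Uniqueness is an energy argument. For two solutions, half the time derivative of the squared
`L²` norms of the differences is a pair of cross terms minus `∫ (d m - d m') (m - m')`. The cross
terms cancel by parts because the pressure difference vanishes at both ends, and the last integral
is nonnegative because `d` is increasing (`IsSolution.eqOn`).

Existence reduces to a scalar transport equation. Subtract a lift `uP` with the boundary values and
`∂ₓuP = g - k`, and a lift `uM` with `∂ₓuM = f`. Extend the remainder of `p` oddly and that of `m`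
evenly to the circle of length 2; oddness and periodicity encode the zero boundary condition for
`p`. Since `∂ₓ` exchanges parities, the system becomes one equation for the sum `w` of the two
extensions: `∂ₜw + ∂ₓw + d(M + w_even) - k = 0`, with `M` the even extension of `uM`.

In the moving frame `v(t, x) = w(t, x + t)` this is an ordinary differential equation in the
continuous functions on the circle. With `d` truncated it is globally Lipschitz and Picard iteration
applies; a maximum principle based on monotonicity gives a sup bound independent of the truncation,
so the truncation is inactive (`exists_hasDerivAt_nonlinShift`).

It remains to gain a derivative. The initial value is weakly differentiable on the circle, so the
time difference quotients of `w` converge at time zero. By Gronwall in `L²` they converge at all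
times, to the solution of the linearised equation (`tendsto_quotientError`). Here the sup bounds
matter: the superposition operator is differentiated with an `L²` error under sup-norm smallness.
Thus `w` is `C¹` in time with values in `L²`, and the equation itself gives `∂ₓw` in `L²`,
continuous in time (`inner_movingToL2_eq`). The odd and even parts of `w`, restricted to `(0,1)`,
give `p` and `m`. -/

noncomputable section

/-! ### Globally Lipschitz differential equations in a Banach space -/

open scoped NNReal in
/-- Global solvability of the initial value problem for a globally Lipschitz right-hand side. -/
theorem exists_forall_hasDerivAt_of_lipschitzWith {E : Type*} [NormedAddCommGroup E]
    [NormedSpace ℝ E] [CompleteSpace E] {f : ℝ → E → E} {K : ℝ≥0}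
    (hL : ∀ t, LipschitzWith K (f t)) (hc : ∀ x, Continuous fun t => f t x) (x₀ : E)
    {T : ℝ} (hT : 0 ≤ T) :
    ∃ v : ℝ → E, Continuous v ∧ v 0 = x₀ ∧ ∀ t ∈ Icc 0 T, HasDerivAt v (f t (v t)) t := by
  have hf : Continuous (Function.uncurry f) :=
    continuous_prod_of_continuous_lipschitzWith' _ K hL hc
  -- The fixed point is sought for `u t = exp (-μ t) v t`. This weight makes the Picard map contract
  -- with factor `K / μ < 1` on all of `[0, T]` at once.
  set μ : ℝ := K + 1 with hμ
  have hμ0 : 0 < μ := by positivity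
  let ext : C(Icc 0 T, E) → ℝ → E := fun u s => Real.exp (μ * s) • u (projIcc 0 T hT s)
  have hext : ∀ u, Continuous (ext u) := fun u => by
    have : Continuous (projIcc 0 T hT) := continuous_projIcc
    fun_prop
  have hint : ∀ u, Continuous fun s => f s (ext u s) := fun u =>
    hf.comp (continuous_id.prodMk (hext u))
  let J : C(Icc 0 T, E) → ℝ → E := fun u t => x₀ + ∫ s in (0 : ℝ)..t, f s (ext u s)
  have hJ : ∀ u t, HasDerivAt (J u) (f t (ext u t)) t := fun u t =>
    (intervalIntegral.integral_hasDerivAt_right ((hint u).intervalIntegrable _ _)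
      ((hint u).stronglyMeasurableAtFilter _ _) (hint u).continuousAt).const_add _
  have hJc : ∀ u, Continuous (J u) := fun u =>
    continuous_iff_continuousAt.2 fun t => (hJ u t).continuousAt
  let F : C(Icc 0 T, E) → C(Icc 0 T, E) := fun u =>
    ⟨fun t => Real.exp (-(μ * t)) • J u t, by
      have := hJc u
      fun_prop⟩
  have hlip : LipschitzWith (K / (K + 1)) F := by
    refine LipschitzWith.of_dist_le_mul fun u u' => ?_
    refine (ContinuousMap.dist_le (by positivity)).2 fun t => ?_
    have h0t : (0 : ℝ) ≤ t := t.2.1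
    have hI : ‖J u t - J u' t‖ ≤ ∫ s in (0 : ℝ)..t, K * Real.exp (μ * s) * dist u u' := by
      have : J u t - J u' t = ∫ s in (0 : ℝ)..t, (f s (ext u s) - f s (ext u' s)) := by
        rw [intervalIntegral.integral_sub ((hint u).intervalIntegrable _ _)
          ((hint u').intervalIntegrable _ _)]
        simp [J]
      rw [this]
      refine intervalIntegral.norm_integral_le_of_norm_le h0t ?_ ?_
      · refine ae_of_all _ fun s _ => ?_
        rw [← dist_eq_norm, mul_assoc]
        refine ((hL s).dist_le_mul _ _).trans ?_
        gcongr
        simp only [ext]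
        rw [dist_smul₀, Real.norm_of_nonneg (Real.exp_pos _).le]
        gcongr
        exact ContinuousMap.dist_apply_le_dist _
      · exact Continuous.intervalIntegrable (by fun_prop) _ _
    have hI2 : ∫ s in (0 : ℝ)..t, K * Real.exp (μ * s) * dist u u'
        = K / μ * (Real.exp (μ * t) - 1) * dist u u' := by
      rw [intervalIntegral.integral_mul_const, intervalIntegral.integral_const_mul,
        intervalIntegral.integral_comp_mul_left _ hμ0.ne', integral_exp]
      simp only [mul_zero, Real.exp_zero, smul_eq_mul]
      ring
    calc dist (F u t) (F u' t) = Real.exp (-(μ * t)) * ‖J u t - J u' t‖ := by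
          change dist (Real.exp (-(μ * t)) • J u t) (Real.exp (-(μ * t)) • J u' t) = _
          rw [dist_smul₀, dist_eq_norm, Real.norm_of_nonneg (Real.exp_pos _).le]
      _ ≤ Real.exp (-(μ * t)) * (K / μ * (Real.exp (μ * t) - 1) * dist u u') := by
          gcongr
          exact hI.trans hI2.le
      _ = K / μ * dist u u' * (1 - Real.exp (-(μ * t))) := by
          have : Real.exp (-(μ * t)) * Real.exp (μ * t) = 1 := by
            rw [← Real.exp_add]; simp
          linear_combination (K / μ * dist u u') * this
      _ ≤ K / μ * dist u u' * 1 := by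
          gcongr
          linarith [Real.exp_pos (-(μ * t))]
      _ = _ := by simp [hμ]
  have hK1 : K / (K + 1) < 1 := by
    rw [div_lt_one (by positivity)]
    exact lt_add_one K
  have : Nonempty C(Icc 0 T, E) := ⟨0⟩
  have hctr : ContractingWith (K / (K + 1)) F := ⟨hK1, hlip⟩
  set u := ContractingWith.fixedPoint F hctr
  have hu : F u = u := hctr.fixedPoint_isFixedPt
  refine ⟨J u, hJc u, by simp [J], fun t ht => ?_⟩
  have : J u t = ext u t := by
    have h1 : u ⟨t, ht⟩ = Real.exp (-(μ * t)) • J u t := by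
      conv_lhs => rw [← hu]
      rfl
    simp only [ext]
    rw [projIcc_of_mem hT ht, h1, smul_smul, ← Real.exp_add]
    simp
  rw [this]
  exact hJ u t

/-! ### Absolutely continuous representatives and `H¹(0,1)` -/

/-- `c` is an absolutely continuous function on `[0,1]` with derivative `a`. -/
def IsPrimitive (c a : ℝ → ℝ) : Prop :=
  IntervalIntegrable a volume 0 1 ∧ ∀ x ∈ Icc (0 : ℝ) 1, c x = c 0 + ∫ t in (0 : ℝ)..x, a t

lemma isPrimitive_integral {a : ℝ → ℝ} (ha : IntervalIntegrable a volume 0 1) (k : ℝ) :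
    IsPrimitive (fun x => k + ∫ t in (0 : ℝ)..x, a t) a :=
  ⟨ha, fun x _ => by simp⟩

lemma ContDiff.isPrimitive {φ : ℝ → ℝ} (h : ContDiff ℝ 1 φ) : IsPrimitive φ (deriv φ) := by
  have hc : Continuous (deriv φ) := h.continuous_deriv le_rfl
  refine ⟨hc.intervalIntegrable _ _, fun x _ => ?_⟩
  rw [intervalIntegral.integral_deriv_eq_sub' φ rfl
    (fun y _ => (h.differentiable one_ne_zero).differentiableAt) hc.continuousOn]
  ring

lemma IsPrimitive.absolutelyContinuousOnInterval {c a : ℝ → ℝ} (h : IsPrimitive c a) :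
    AbsolutelyContinuousOnInterval (fun x => c 0 + ∫ t in (0 : ℝ)..x, a t) 0 1 := by
  have h1 := h.1.absolutelyContinuousOnInterval_intervalIntegral (c := 0) (by simp)
  have h2 : AbsolutelyContinuousOnInterval (fun _ : ℝ => c 0) 0 1 :=
    (contDiff_const (n := 1) (c := c 0)).contDiffOn.absolutelyContinuousOnInterval
  exact h2.add h1

lemma IsPrimitive.continuousOn {c a : ℝ → ℝ} (h : IsPrimitive c a) : ContinuousOn c (Icc 0 1) := by
  have := h.absolutelyContinuousOnInterval.continuousOn
  rw [uIcc_of_le zero_le_one] at this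
  exact this.congr h.2

/-- Integration by parts on `(0,1)`. -/
lemma IsPrimitive.integral_deriv_mul_add {c a e b : ℝ → ℝ} (hc : IsPrimitive c a) (he : IsPrimitive e b) :
    ∫ x in Ioo (0 : ℝ) 1, (a x * e x + c x * b x) = c 1 * e 1 - c 0 * e 0 := by
  have key := AbsolutelyContinuousOnInterval.integral_deriv_mul_eq_sub
    hc.absolutelyContinuousOnInterval he.absolutelyContinuousOnInterval
  have h1 : (1 : ℝ) ∈ Icc (0 : ℝ) 1 := by simp
  rw [← hc.2 1 h1, ← he.2 1 h1] at key
  simp only [intervalIntegral.integral_same, add_zero] at key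
  rw [← key, ← integral_Ioc_eq_integral_Ioo, ← intervalIntegral.integral_of_le zero_le_one]
  refine intervalIntegral.integral_congr_ae ?_
  filter_upwards [hc.1.ae_hasDerivAt_integral, he.1.ae_hasDerivAt_integral] with x hx1 hx2 hx
  have hx' : x ∈ uIcc (0 : ℝ) 1 := uIoc_subset_uIcc hx
  have hx'' : x ∈ Icc (0 : ℝ) 1 := by rwa [uIcc_of_le zero_le_one] at hx'
  have e1 := ((hx1 hx' 0 (by simp)).const_add (c 0)).deriv
  have e2 := ((hx2 hx' 0 (by simp)).const_add (e 0)).deriv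
  rw [e1, e2, ← hc.2 x hx'', ← he.2 x hx'']

lemma IsPrimitive.integrable_mul_left {c a e b : ℝ → ℝ} (hc : IsPrimitive c a)
    (he : IsPrimitive e b) : Integrable (fun x => a x * e x) unitMeasure := by
  have he' : ContinuousOn e (uIcc 0 1) := by
    rw [uIcc_of_le zero_le_one]; exact he.continuousOn
  have := hc.1.mul_continuousOn he'
  rw [intervalIntegrable_iff_integrableOn_Ioo_of_le zero_le_one] at this
  exact this

lemma IsPrimitive.integral_mul {c a e b : ℝ → ℝ} (hc : IsPrimitive c a) (he : IsPrimitive e b) :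
    ∫ x in Ioo (0 : ℝ) 1, c x * b x
      = c 1 * e 1 - c 0 * e 0 - ∫ x in Ioo (0 : ℝ) 1, a x * e x := by
  rw [← hc.integral_deriv_mul_add he, integral_add (hc.integrable_mul_left he)]
  · ring
  · simpa only [mul_comm] using he.integrable_mul_left hc

lemma L2.integrable (u : L2) : Integrable u unitMeasure :=
  (Lp.memLp u).integrable (by norm_num)

lemma L2.intervalIntegrable (u : L2) : IntervalIntegrable u volume 0 1 :=
  (intervalIntegrable_iff_integrableOn_Ioo_of_le zero_le_one).2 u.integrable

lemma IsTestFunction.isPrimitive {φ : ℝ → ℝ} (h : IsTestFunction φ) : IsPrimitive φ (deriv φ) :=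
  (h.1.of_le (by simp)).isPrimitive

lemma IsTestFunction.eq_zero {φ : ℝ → ℝ} (h : IsTestFunction φ) {x : ℝ} (hx : x ∉ Ioo (0 : ℝ) 1) :
    φ x = 0 :=
  image_eq_zero_of_notMem_tsupport fun h' => hx (h.2.2 h')

/-- Integration by parts leaves no boundary term, since test functions vanish at 0 and 1. -/
lemma isWeakDeriv_of_isPrimitive {u w : L2} {c : ℝ → ℝ} (hc : IsPrimitive c w)
    (hu : c =ᵐ[unitMeasure] u) : IsWeakDeriv u w := by
  intro φ hφ
  have := hc.integral_mul hφ.isPrimitive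
  rw [hφ.eq_zero (x := 0) (by simp), hφ.eq_zero (x := 1) (by simp)] at this
  have e : ∫ x in Ioo (0 : ℝ) 1, u x * deriv φ x = ∫ x in Ioo (0 : ℝ) 1, c x * deriv φ x := by
    refine integral_congr_ae ?_
    filter_upwards [hu] with x hx
    rw [hx]
  rw [e, this]
  ring

lemma IsTestFunction.sub {φ ψ : ℝ → ℝ} (hφ : IsTestFunction φ) (hψ : IsTestFunction ψ) :
    IsTestFunction (φ - ψ) :=
  ⟨hφ.1.sub hψ.1, hφ.2.1.sub hψ.2.1,
    (tsupport_sub φ ψ).trans (union_subset hφ.2.2 hψ.2.2)⟩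

lemma IsTestFunction.const_mul {φ : ℝ → ℝ} (hφ : IsTestFunction φ) (k : ℝ) :
    IsTestFunction (fun x => k * φ x) :=
  ⟨contDiff_const.mul hφ.1, hφ.2.1.mul_left, (tsupport_mul_subset_right).trans hφ.2.2⟩

lemma exists_isTestFunction_integral_eq_one :
    ∃ φ : ℝ → ℝ, IsTestFunction φ ∧ ∫ x in Ioo (0 : ℝ) 1, φ x = 1 := by
  let B : ContDiffBump (1 / 2 : ℝ) := ⟨1 / 8, 1 / 4, by norm_num, by norm_num⟩
  have hs : tsupport (B.normed volume) ⊆ Ioo (0 : ℝ) 1 := by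
    rw [B.tsupport_normed_eq]
    intro x hx
    rw [Metric.mem_closedBall, Real.dist_eq, abs_le] at hx
    have : B.rOut = 1 / 4 := rfl
    constructor <;> linarith [hx.1, hx.2]
  refine ⟨B.normed volume, ⟨B.contDiff_normed, B.hasCompactSupport_normed, hs⟩, ?_⟩
  rw [setIntegral_eq_integral_of_forall_compl_eq_zero fun x hx => ?_]
  · exact B.integral_normed
  · exact image_eq_zero_of_notMem_tsupport fun h => hx (hs h)

/-- The primitive from 0 vanishes to the left of the support of `η`, and to the right of it because
the mean is zero. -/
lemma IsTestFunction.exists_deriv_eq {η : ℝ → ℝ} (hη : IsTestFunction η)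
    (h0 : ∫ x in Ioo (0 : ℝ) 1, η x = 0) : ∃ ψ, IsTestFunction ψ ∧ deriv ψ = η := by
  have hcont : Continuous η := hη.1.continuous
  -- The point 1/2 only ensures that the compact set is nonempty, so that it has a least and a
  -- greatest element.
  have hK : IsCompact (insert (1 / 2 : ℝ) (tsupport η)) := (hη.2.1.isCompact).insert _
  have hKs : insert (1 / 2 : ℝ) (tsupport η) ⊆ Ioo (0 : ℝ) 1 :=
    insert_subset (by norm_num) hη.2.2
  obtain ⟨a, haK, ha⟩ := hK.exists_isLeast (insert_nonempty _ _)
  obtain ⟨b, hbK, hb⟩ := hK.exists_isGreatest (insert_nonempty _ _)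
  have ha0 := hKs haK
  have hb0 := hKs hbK
  have hlt : ∀ x, x < a → η x = 0 := fun x hx =>
    image_eq_zero_of_notMem_tsupport fun h => absurd (ha (mem_insert_of_mem _ h)) (not_le.2 hx)
  have hgt : ∀ x, b < x → η x = 0 := fun x hx =>
    image_eq_zero_of_notMem_tsupport fun h => absurd (hb (mem_insert_of_mem _ h)) (not_le.2 hx)
  have hd : ∀ x, HasDerivAt (fun y => ∫ t in (0 : ℝ)..y, η t) (η x) x := fun x =>
    intervalIntegral.integral_hasDerivAt_right (hcont.intervalIntegrable _ _)
      (hcont.stronglyMeasurableAtFilter _ _) hcont.continuousAt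
  have hderiv : deriv (fun y => ∫ t in (0 : ℝ)..y, η t) = η := funext fun x => (hd x).deriv
  have hz : ∀ x ∉ Icc a b, ∫ t in (0 : ℝ)..x, η t = 0 := by
    intro x hx
    by_cases hxa : x < a
    · refine intervalIntegral.integral_zero_ae (ae_of_all _ fun t ht => hlt t ?_)
      exact ht.2.trans_lt (max_lt ha0.1 hxa)
    · have hxb : b < x := by
        by_contra h
        exact hx ⟨not_lt.1 hxa, not_lt.1 h⟩
      rw [← intervalIntegral.integral_add_adjacent_intervals (b := 1)
        (hcont.intervalIntegrable _ _) (hcont.intervalIntegrable _ _),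
        intervalIntegral.integral_of_le zero_le_one, integral_Ioc_eq_integral_Ioo, h0, zero_add]
      refine intervalIntegral.integral_zero_ae (ae_of_all _ fun t ht => hgt t ?_)
      exact (lt_min hb0.2 hxb).trans ht.1
  have hsupp : tsupport (fun y => ∫ t in (0 : ℝ)..y, η t) ⊆ Icc a b :=
    closure_minimal (fun x hx => by
      by_contra h
      exact hx (hz x h)) isClosed_Icc
  refine ⟨fun y => ∫ t in (0 : ℝ)..y, η t, ⟨?_, ?_, ?_⟩, hderiv⟩
  · rw [contDiff_infty_iff_deriv]
    exact ⟨fun x => (hd x).differentiableAt, by rw [hderiv]; exact hη.1⟩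
  · exact HasCompactSupport.of_support_subset_isCompact isCompact_Icc
      (subset_closure.trans hsupp)
  · exact hsupp.trans fun x hx => ⟨ha0.1.trans_le hx.1, hx.2.trans_lt hb0.2⟩

/-- A square-integrable function on `(0,1)` with vanishing weak derivative is constant. -/
lemma ae_eq_const_of_forall_integral_mul_deriv {w : ℝ → ℝ} (hw : MemLp w 2 unitMeasure)
    (h : ∀ φ, IsTestFunction φ → ∫ x in Ioo (0 : ℝ) 1, w x * deriv φ x = 0) :
    ∃ k : ℝ, w =ᵐ[unitMeasure] fun _ => k := by
  obtain ⟨φ₀, hφ₀, h1⟩ := exists_isTestFunction_integral_eq_one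
  refine ⟨∫ x in Ioo (0 : ℝ) 1, w x * φ₀ x, ?_⟩
  set k := ∫ x in Ioo (0 : ℝ) 1, w x * φ₀ x
  have hL : MemLp (fun x => w x - k) 2 unitMeasure := hw.sub (memLp_const k)
  have hloc : LocallyIntegrableOn (fun x => w x - k) (Ioo (0 : ℝ) 1) volume :=
    IntegrableOn.locallyIntegrableOn (μ := volume) (hL.integrable (by norm_num))
  have key := isOpen_Ioo.ae_eq_zero_of_integral_contDiff_smul_eq_zero hloc fun φ hφ hc hs => ?_
  · refine (ae_restrict_iff' measurableSet_Ioo).2 ?_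
    filter_upwards [key] with x hx hm
    exact sub_eq_zero.1 (hx hm)
  have ht : IsTestFunction φ := ⟨hφ, hc, hs⟩
  have hi : ∀ {ψ}, IsTestFunction ψ → Integrable ψ unitMeasure := fun hψ =>
    hψ.memLp.integrable (by norm_num)
  have hwi : ∀ {ψ}, IsTestFunction ψ → Integrable (fun x => w x * ψ x) unitMeasure := fun hψ =>
    hw.integrable_mul hψ.memLp
  -- Subtracting this multiple of `φ₀` makes the mean zero, so the difference is the derivative of a
  -- test function and is annihilated by `w`.
  have hη := ht.sub (hφ₀.const_mul (∫ x in Ioo (0 : ℝ) 1, φ x))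
  obtain ⟨ψ, hψ, hψd⟩ := hη.exists_deriv_eq (by
    simp only [Pi.sub_apply]
    rw [integral_sub (hi ht) ((hi hφ₀).const_mul _), integral_const_mul, h1]
    ring)
  have h2 := h ψ hψ
  rw [hψd] at h2
  have h3 : ∀ x, w x * (φ - fun x => (∫ x in Ioo (0 : ℝ) 1, φ x) * φ₀ x) x
      = w x * φ x - (∫ x in Ioo (0 : ℝ) 1, φ x) * (w x * φ₀ x) := fun x => by
    simp only [Pi.sub_apply]; ring
  simp_rw [h3] at h2
  rw [integral_sub (hwi ht) ((hwi hφ₀).const_mul _), integral_const_mul] at h2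
  have h4 : ∀ x, φ x • (w x - k) = w x * φ x - k * φ x := fun x => by
    simp only [smul_eq_mul]; ring
  have h5 : ∫ x in Ioo (0 : ℝ) 1, φ x • (w x - k) = 0 := by
    simp_rw [h4]
    rw [integral_sub (hwi ht) ((hi ht).const_mul _), integral_const_mul]
    linarith
  rw [← h5]
  refine (setIntegral_eq_integral_of_forall_compl_eq_zero fun x hx => ?_).symm
  simp [ht.eq_zero hx]

lemma IsPrimitive.memLp {c a : ℝ → ℝ} (h : IsPrimitive c a) : MemLp c 2 unitMeasure := by
  obtain ⟨C, hC⟩ := isCompact_Icc.exists_bound_of_continuousOn h.continuousOn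
  refine MemLp.of_bound ?_ C ?_
  · exact (h.continuousOn.mono Ioo_subset_Icc_self).aestronglyMeasurable measurableSet_Ioo
  · exact (ae_restrict_iff' measurableSet_Ioo).2
      (ae_of_all _ fun x hx => hC x (Ioo_subset_Icc_self hx))

/-- Every element of `H¹(0,1)` has an absolutely continuous representative. -/
lemma H1.exists_isPrimitive (u : H1) :
    ∃ c : ℝ → ℝ, IsPrimitive c u.dx ∧ c =ᵐ[unitMeasure] u.fn := by
  have hC := isPrimitive_integral u.dx.intervalIntegrable 0
  have hu : IsWeakDeriv u.fn u.dx := u.2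
  -- The function and the primitive of its weak derivative have the same weak derivative, hence
  -- differ by a constant.
  obtain ⟨k, hk⟩ := ae_eq_const_of_forall_integral_mul_deriv ((Lp.memLp u.fn).sub hC.memLp)
    fun φ hφ => by
      have h1 := hu φ hφ
      have h2 := isWeakDeriv_of_isPrimitive hC (u := hC.memLp.toLp _) hC.memLp.coeFn_toLp.symm φ hφ
      have h3 : ∫ x in Ioo (0 : ℝ) 1, hC.memLp.toLp _ x * deriv φ x
          = ∫ x in Ioo (0 : ℝ) 1, (0 + ∫ t in (0 : ℝ)..x, u.dx t) * deriv φ x := by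
        refine integral_congr_ae ?_
        filter_upwards [hC.memLp.coeFn_toLp] with x hx
        rw [hx]
      simp only [Pi.sub_apply, sub_mul]
      refine (integral_sub (u.fn.integrable_mul hφ.memLp_deriv)
        (hC.memLp.integrable_mul hφ.memLp_deriv)).trans ?_
      rw [h1, ← h2, h3]
      exact sub_self _
  refine ⟨_, isPrimitive_integral u.dx.intervalIntegrable k, ?_⟩
  filter_upwards [hk] with x hx
  simp only [Pi.sub_apply] at hx
  linarith

/-- The element of `H¹(0,1)` with representative `c`. -/
lemma IsPrimitive.exists_H1 {c : ℝ → ℝ} {a : L2} (h : IsPrimitive c a) :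
    ∃ u : H1, u.dx = a ∧ c =ᵐ[unitMeasure] u.fn :=
  ⟨⟨WithLp.toLp 2 (h.memLp.toLp c, a),
    isWeakDeriv_of_isPrimitive h h.memLp.coeFn_toLp.symm⟩, rfl, h.memLp.coeFn_toLp.symm⟩

lemma eqOn_Icc_of_ae_eq {c e : ℝ → ℝ} (hc : ContinuousOn c (Icc 0 1))
    (he : ContinuousOn e (Icc 0 1)) (h : c =ᵐ[unitMeasure] e) : EqOn c e (Icc 0 1) :=
  Measure.eqOn_Icc_of_ae_eq volume zero_ne_one
    (by
      rw [← Measure.restrict_congr_set Ioo_ae_eq_Icc]; exact h) hc he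

lemma H1.HasBoundaryValues.eq_of_isPrimitive {u : H1} {h : Fin 2 → ℝ} (hu : u.HasBoundaryValues h)
    {c a : ℝ → ℝ} (hc : IsPrimitive c a) (hcu : c =ᵐ[unitMeasure] u.fn) :
    c 0 = h 0 ∧ c 1 = h 1 := by
  obtain ⟨e, he, heu, h0, h1⟩ := hu
  have := eqOn_Icc_of_ae_eq hc.continuousOn he (hcu.trans heu.symm)
  rw [← h0, ← h1]
  exact ⟨this (by simp), this (by simp)⟩

lemma H1.fn_sub (u v : H1) : (u - v).fn = u.fn - v.fn := rfl

lemma H1.dx_sub (u v : H1) : (u - v).dx = u.dx - v.dx := rfl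

lemma H1.ext {u v : H1} (hf : u.fn = v.fn) (hd : u.dx = v.dx) : u = v :=
  Subtype.ext ((WithLp.ofLp_injective 2) (Prod.ext hf hd))

lemma H1.ext_fn {u v : H1} (h : u.fn = v.fn) : u = v := by
  have hu : IsWeakDeriv u.fn u.dx := u.2
  have hv : IsWeakDeriv v.fn v.dx := v.2
  rw [h] at hu
  exact H1.ext h (hu.unique hv)

lemma H1.HasBoundaryValues.sub {u v : H1} {h k : Fin 2 → ℝ} (hu : u.HasBoundaryValues h)
    (hv : v.HasBoundaryValues k) : (u - v).HasBoundaryValues (h - k) := by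
  obtain ⟨c, hc, hcu, h0, h1⟩ := hu
  obtain ⟨e, he, hev, k0, k1⟩ := hv
  refine ⟨c - e, hc.sub he, ?_, by simp [h0, k0], by simp [h1, k1]⟩
  rw [H1.fn_sub]
  exact (hcu.sub hev).trans (Lp.coeFn_sub _ _).symm

lemma L2.inner_eq_integral (u v : L2) :
    inner ℝ u v = ∫ x in Ioo (0 : ℝ) 1, u x * v x := by
  rw [MeasureTheory.L2.inner_def]
  simp [mul_comm]

/-- Integration by parts in `H¹(0,1)` when one factor vanishes on the boundary. -/
lemma H1.inner_dx_add_inner_dx {u v : H1} (hu : u.HasBoundaryValues 0) :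
    inner ℝ u.dx v.fn + inner ℝ u.fn v.dx = 0 := by
  obtain ⟨c, hc, hcu⟩ := u.exists_isPrimitive
  obtain ⟨e, he, hev⟩ := v.exists_isPrimitive
  have hb := hu.eq_of_isPrimitive hc hcu
  rw [L2.inner_eq_integral, L2.inner_eq_integral,
    ← integral_add (u.dx.integrable_mul (Lp.memLp v.fn)) (u.fn.integrable_mul (Lp.memLp v.dx))]
  have := hc.integral_deriv_mul_add he
  rw [hb.1, hb.2] at this
  simp only [Pi.zero_apply, zero_mul, sub_zero] at this
  rw [← this]
  refine integral_congr_ae ?_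
  filter_upwards [hcu, hev] with x h1 h2
  rw [h1, h2]

/-! ### Uniqueness -/

lemma IsDamping.strictMono {d : ℝ → ℝ} (hd : IsDamping d) : StrictMono d := by
  obtain ⟨_, _, d₀, d₁, d₂, p, h0, _, _, _, h⟩ := hd
  exact strictMono_of_deriv_pos fun x => h0.trans (h x).1

/-- Uniqueness of solutions, by the energy method. -/
lemma IsSolution.eqOn {d : ℝ → ℝ} (hd : Monotone d) {f g : L2} {h : Fin 2 → ℝ} {p₀ m₀ : H1}
    {T : ℝ} (hT : 0 < T) {p m p' m' : ℝ → H1} (hs : IsSolution d f g h p₀ m₀ T p m)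
    (hs' : IsSolution d f g h p₀ m₀ T p' m') :
    EqOn p p' (Icc 0 T) ∧ EqOn m m' (Icc 0 T) := by
  set P : ℝ → L2 := fun t => (p t).fn - (p' t).fn with hP
  set M : ℝ → L2 := fun t => (m t).fn - (m' t).fn with hM
  have hPd : ContDiffOn ℝ 1 P (Icc 0 T) := hs.contDiffOn_p.sub hs'.contDiffOn_p
  have hMd : ContDiffOn ℝ 1 M (Icc 0 T) := hs.contDiffOn_m.sub hs'.contDiffOn_m
  set E : ℝ → ℝ := fun t => ‖P t‖ ^ 2 + ‖M t‖ ^ 2 with hE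
  have hud : UniqueDiffOn ℝ (Icc 0 T) := uniqueDiffOn_Icc hT
  have hderiv : ∀ t ∈ Icc 0 T, HasDerivWithinAt E
      (2 * inner ℝ (P t) (derivWithin P (Icc 0 T) t) +
        2 * inner ℝ (M t) (derivWithin M (Icc 0 T) t)) (Icc 0 T) t := fun t ht =>
    ((hPd.differentiableOn one_ne_zero t ht).hasDerivWithinAt.norm_sq).add
      ((hMd.differentiableOn one_ne_zero t ht).hasDerivWithinAt.norm_sq)
  have hle : ∀ t ∈ Icc 0 T, 2 * inner ℝ (P t) (derivWithin P (Icc 0 T) t) +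
        2 * inner ℝ (M t) (derivWithin M (Icc 0 T) t) ≤ 0 := by
    intro t ht
    have hPt : derivWithin P (Icc 0 T) t = -(m t - m' t).dx := by
      rw [hP, derivWithin_fun_sub (hs.contDiffOn_p.differentiableOn one_ne_zero t ht)
        (hs'.contDiffOn_p.differentiableOn one_ne_zero t ht)]
      refine Lp.ext ?_
      rw [H1.dx_sub]
      filter_upwards [hs.eq_p t ht, hs'.eq_p t ht, Lp.coeFn_neg ((m t).dx - (m' t).dx),
        Lp.coeFn_sub (m t).dx (m' t).dx,
        Lp.coeFn_sub (derivWithin (fun s => (p s).fn) (Icc 0 T) t)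
          (derivWithin (fun s => (p' s).fn) (Icc 0 T) t)] with x h1 h2 h3 h4 h5
      rw [h5, h3, Pi.neg_apply, h4, Pi.sub_apply, Pi.sub_apply]
      linarith
    -- The two sides differ by `∫ (m - m') (d m - d m')`, whose integrand is nonnegative as `d` is
    -- monotone.
    have hMt : inner ℝ (M t) (derivWithin M (Icc 0 T) t) ≤ -inner ℝ (M t) (p t - p' t).dx := by
      rw [hM, derivWithin_fun_sub (hs.contDiffOn_m.differentiableOn one_ne_zero t ht)
        (hs'.contDiffOn_m.differentiableOn one_ne_zero t ht), ← inner_neg_right, ← sub_nonneg,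
        ← inner_sub_right, L2.inner_eq_integral]
      refine integral_nonneg_of_ae ?_
      rw [H1.dx_sub]
      filter_upwards [hs.eq_m t ht, hs'.eq_m t ht, Lp.coeFn_neg ((p t).dx - (p' t).dx),
        Lp.coeFn_sub (p t).dx (p' t).dx, Lp.coeFn_sub (m t).fn (m' t).fn,
        Lp.coeFn_sub (derivWithin (fun s => (m s).fn) (Icc 0 T) t)
          (derivWithin (fun s => (m' s).fn) (Icc 0 T) t),
        Lp.coeFn_sub (-((p t).dx - (p' t).dx)) (derivWithin (fun s => (m s).fn) (Icc 0 T) t -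
          derivWithin (fun s => (m' s).fn) (Icc 0 T) t)] with x h1 h2 h3 h4 h5 h6 h7
      rw [h7, Pi.sub_apply, h3, h6, Pi.neg_apply, h4, h5]
      simp only [Pi.sub_apply, Pi.zero_apply]
      have e : -((p t).dx x - (p' t).dx x) - (derivWithin (fun s => (m s).fn) (Icc 0 T) t x -
          derivWithin (fun s => (m' s).fn) (Icc 0 T) t x)
          = d ((m t).fn x) - d ((m' t).fn x) := by linarith
      rw [e]
      rcases le_total ((m t).fn x) ((m' t).fn x) with hx | hx
      · exact mul_nonneg_of_nonpos_of_nonpos (sub_nonpos.2 hx) (sub_nonpos.2 (hd hx))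
      · exact mul_nonneg (sub_nonneg.2 hx) (sub_nonneg.2 (hd hx))
    have hbd : (p t - p' t).HasBoundaryValues 0 := by
      simpa using (hs.boundary t ht).sub (hs'.boundary t ht)
    have hibp := H1.inner_dx_add_inner_dx (v := m t - m' t) hbd
    rw [H1.fn_sub, H1.fn_sub, real_inner_comm] at hibp
    rw [hPt, inner_neg_right]
    change inner ℝ (M t) (p t - p' t).dx + inner ℝ (P t) (m t - m' t).dx = 0 at hibp
    linarith
  have hanti : AntitoneOn E (Icc 0 T) := by
    refine antitoneOn_of_hasDerivWithinAt_nonpos (convex_Icc 0 T)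
      (fun t ht => (hderiv t ht).continuousWithinAt)
      (fun t ht => (hderiv t (interior_subset ht)).mono interior_subset)
      (fun t ht => hle t (interior_subset ht))
  have h00 : (0 : ℝ) ∈ Icc 0 T := ⟨le_rfl, hT.le⟩
  have hE0 : E 0 = 0 := by
    simp [hE, hP, hM, hs.init_p, hs.init_m, hs'.init_p, hs'.init_m]
  have hz : ∀ t ∈ Icc 0 T, P t = 0 ∧ M t = 0 := by
    intro t ht
    have h1 : ‖P t‖ ^ 2 + ‖M t‖ ^ 2 ≤ 0 := (hanti h00 ht ht.1).trans hE0.le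
    constructor
    · rw [← norm_eq_zero]
      nlinarith [sq_nonneg ‖P t‖, sq_nonneg ‖M t‖]
    · rw [← norm_eq_zero]
      nlinarith [sq_nonneg ‖P t‖, sq_nonneg ‖M t‖]
  exact ⟨fun t ht => H1.ext_fn (sub_eq_zero.1 (hz t ht).1),
    fun t ht => H1.ext_fn (sub_eq_zero.1 (hz t ht).2)⟩

/-! ### The circle of length 2: translation, reflection and parity -/

instance : Fact ((0 : ℝ) < 2) := ⟨two_pos⟩

/-- The circle of length `2`, i.e. the double of the interval `[0,1]`. -/
abbrev Dbl : Type := AddCircle (2 : ℝ)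

/-- Square-integrable functions on the circle of length `2`. -/
abbrev L2Dbl : Type := Lp ℝ 2 (volume : Measure Dbl)

/-- The embedding of continuous functions into `L²` of the circle. -/
abbrev contToL2 : C(Dbl, ℝ) →L[ℝ] L2Dbl := ContinuousMap.toLp 2 volume ℝ

lemma coeFn_contToL2 (w : C(Dbl, ℝ)) : contToL2 w =ᵐ[volume] w :=
  ContinuousMap.coeFn_toLp volume w

/-- Translation of continuous functions on the circle. -/
def shiftC (t : ℝ) (w : C(Dbl, ℝ)) : C(Dbl, ℝ) := w.comp ⟨fun x => x + (t : Dbl), by fun_prop⟩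

@[simp] lemma shiftC_apply (t : ℝ) (w : C(Dbl, ℝ)) (x : Dbl) : shiftC t w x = w (x + t) := rfl

/-- Translation of square-integrable functions on the circle. -/
def shift (t : ℝ) : L2Dbl →ₗᵢ[ℝ] L2Dbl :=
  Lp.compMeasurePreservingₗᵢ ℝ (fun x => x + (t : Dbl)) (measurePreserving_add_right volume _)

/-- Reflection of square-integrable functions on the circle. -/
def reflect : L2Dbl →ₗᵢ[ℝ] L2Dbl :=
  Lp.compMeasurePreservingₗᵢ ℝ (fun x => -x) (Measure.measurePreserving_neg volume)

lemma coeFn_shift (t : ℝ) (u : L2Dbl) : shift t u =ᵐ[volume] fun x => u (x + t) :=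
  Lp.coeFn_compMeasurePreserving u (measurePreserving_add_right volume _)

lemma coeFn_reflect (u : L2Dbl) : reflect u =ᵐ[volume] fun x => u (-x) :=
  Lp.coeFn_compMeasurePreserving u (Measure.measurePreserving_neg volume)

lemma shift_contToL2 (t : ℝ) (w : C(Dbl, ℝ)) : shift t (contToL2 w) = contToL2 (shiftC t w) := by
  refine Lp.ext ?_
  have := (measurePreserving_add_right volume (t : Dbl)).quasiMeasurePreserving.ae_eq_comp
    (coeFn_contToL2 w)
  filter_upwards [coeFn_shift t (contToL2 w), this, coeFn_contToL2 (shiftC t w)] with x h1 h2 h3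
  rw [h1, h3]
  exact h2

lemma reflect_contToL2 (w : C(Dbl, ℝ)) :
    reflect (contToL2 w) = contToL2 (w.comp ⟨fun x => -x, continuous_neg⟩) := by
  refine Lp.ext ?_
  have := (Measure.measurePreserving_neg (volume : Measure Dbl)).quasiMeasurePreserving.ae_eq_comp
    (coeFn_contToL2 w)
  filter_upwards [coeFn_reflect (contToL2 w), this,
    coeFn_contToL2 (w.comp ⟨fun x => -x, continuous_neg⟩)] with x h1 h2 h3
  rw [h1, h3]
  exact h2

lemma shift_shift (s t : ℝ) (u : L2Dbl) : shift s (shift t u) = shift (s + t) u := by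
  refine Lp.ext ?_
  have := (measurePreserving_add_right volume (s : Dbl)).quasiMeasurePreserving.ae_eq_comp
    (coeFn_shift t u)
  filter_upwards [coeFn_shift s (shift t u), this, coeFn_shift (s + t) u] with x h1 h2 h3
  rw [h1, h3]
  refine h2.trans ?_
  simp only [Function.comp, AddCircle.coe_add, add_assoc]

lemma shift_zero (u : L2Dbl) : shift 0 u = u := by
  refine Lp.ext ?_
  filter_upwards [coeFn_shift 0 u] with x h1
  simpa using h1

lemma shift_shift_neg (t : ℝ) (u : L2Dbl) : shift t (shift (-t) u) = u := by
  rw [shift_shift, add_neg_cancel, shift_zero]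

lemma inner_shift_left (t : ℝ) (u v : L2Dbl) :
    inner ℝ (shift t u) v = inner ℝ u (shift (-t) v) := by
  conv_lhs => rw [← shift_shift_neg t v]
  exact (shift t).inner_map_map _ _

/-- Strong continuity of the translation group. Translations are not norm continuous as operators,
so continuity is stated jointly in time and vector. -/
lemma continuous_shift : Continuous fun q : ℝ × L2Dbl => shift q.1 q.2 := by
  let F : ℝ × L2Dbl → C(Dbl, Dbl) := fun q => ⟨fun x => x + (q.1 : Dbl), by fun_prop⟩
  have hF : Continuous F := by
    refine ContinuousMap.continuous_of_continuous_uncurry _ ?_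
    change Continuous fun z : (ℝ × L2Dbl) × Dbl => z.2 + (z.1.1 : Dbl)
    have : Continuous (fun t : ℝ => (t : Dbl)) := AddCircle.continuous_mk' 2
    fun_prop
  have hm : ∀ q : ℝ × L2Dbl, MeasurePreserving (F q) volume volume := fun q =>
    measurePreserving_add_right volume (q.1 : Dbl)
  have := Continuous.compMeasurePreservingLp (p := 2) (f := fun q : ℝ × L2Dbl => q.2)
    continuous_snd hF hm ENNReal.ofNat_ne_top
  exact this

lemma continuous_shiftC : Continuous fun q : ℝ × C(Dbl, ℝ) => shiftC q.1 q.2 := by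
  refine ContinuousMap.continuous_of_continuous_uncurry _ ?_
  change Continuous fun z : (ℝ × C(Dbl, ℝ)) × Dbl => z.1.2 (z.2 + (z.1.1 : Dbl))
  have : Continuous (fun t : ℝ => (t : Dbl)) := AddCircle.continuous_mk' 2
  fun_prop

lemma measurePreserving_coe_dbl :
    MeasurePreserving (fun x : ℝ => (x : Dbl)) (volume.restrict (Ioc 0 (0 + 2))) volume :=
  AddCircle.measurePreserving_mk 2 0

lemma unitMeasure_le : unitMeasure ≤ volume.restrict (Ioc (0 : ℝ) (0 + 2)) :=
  Measure.restrict_mono (Ioo_subset_Ioc_self.trans (Ioc_subset_Ioc_right (by norm_num))) le_rfl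

lemma ae_eq_comp_coe {u v : Dbl → ℝ} (h : u =ᵐ[volume] v) :
    (fun x : ℝ => u x) =ᵐ[unitMeasure] fun x : ℝ => v x :=
  (Measure.absolutelyContinuous_of_le unitMeasure_le).ae_le
    (measurePreserving_coe_dbl.quasiMeasurePreserving.ae_eq_comp h)

lemma memLp_comp_coe {u : Dbl → ℝ} (hu : MemLp u 2 volume) :
    MemLp (fun x : ℝ => u x) 2 unitMeasure :=
  (hu.comp_measurePreserving measurePreserving_coe_dbl).mono_measure unitMeasure_le

/-- Restriction of functions on the circle to the unit interval. -/
def restr : L2Dbl →L[ℝ] L2 :=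
  LinearMap.mkContinuous
    { toFun := fun u => (memLp_comp_coe (Lp.memLp u)).toLp _
      map_add' := fun u v => by
        refine Lp.ext ?_
        filter_upwards [(memLp_comp_coe (Lp.memLp u)).coeFn_toLp,
          (memLp_comp_coe (Lp.memLp v)).coeFn_toLp, (memLp_comp_coe (Lp.memLp (u + v))).coeFn_toLp,
          ae_eq_comp_coe (Lp.coeFn_add u v),
          Lp.coeFn_add ((memLp_comp_coe (Lp.memLp u)).toLp _)
            ((memLp_comp_coe (Lp.memLp v)).toLp _)] with x h1 h2 h3 h4 h5
        rw [h3, h5, Pi.add_apply, h1, h2, h4, Pi.add_apply]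
      map_smul' := fun c u => by
        refine Lp.ext ?_
        filter_upwards [(memLp_comp_coe (Lp.memLp u)).coeFn_toLp,
          (memLp_comp_coe (Lp.memLp (c • u))).coeFn_toLp,
          ae_eq_comp_coe (Lp.coeFn_smul c u),
          Lp.coeFn_smul c ((memLp_comp_coe (Lp.memLp u)).toLp _)] with x h1 h2 h3 h4
        rw [h2, h3, RingHom.id_apply, h4, Pi.smul_apply, Pi.smul_apply, h1] }
    1 (fun u => by
      simp only [LinearMap.coe_mk, AddHom.coe_mk, one_mul]
      rw [Lp.norm_toLp, Lp.norm_def]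
      refine ENNReal.toReal_mono (Lp.memLp u).2.ne ?_
      refine (eLpNorm_mono_measure _ unitMeasure_le).trans ?_
      exact (eLpNorm_comp_measurePreserving (Lp.aestronglyMeasurable u)
        measurePreserving_coe_dbl).le)

lemma coeFn_restr (u : L2Dbl) : restr u =ᵐ[unitMeasure] fun x : ℝ => u x :=
  (memLp_comp_coe (Lp.memLp u)).coeFn_toLp

/-- The even part on the circle. -/
def evenProj : L2Dbl →L[ℝ] L2Dbl :=
  (1 / 2 : ℝ) • (ContinuousLinearMap.id ℝ L2Dbl + reflect.toContinuousLinearMap)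

/-- The even part, restricted to the unit interval. -/
def evenPart : L2Dbl →L[ℝ] L2 := (1 / 2 : ℝ) • (restr + restr ∘L reflect.toContinuousLinearMap)

/-- The odd part, restricted to the unit interval. -/
def oddPart : L2Dbl →L[ℝ] L2 := (1 / 2 : ℝ) • (restr - restr ∘L reflect.toContinuousLinearMap)

lemma coeFn_restr_contToL2 (w : C(Dbl, ℝ)) :
    restr (contToL2 w) =ᵐ[unitMeasure] fun x : ℝ => w x :=
  (coeFn_restr _).trans (ae_eq_comp_coe (coeFn_contToL2 w))

lemma coeFn_restr_reflect_contToL2 (w : C(Dbl, ℝ)) :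
    restr (reflect (contToL2 w)) =ᵐ[unitMeasure] fun x : ℝ => w (-x : ℝ) := by
  rw [reflect_contToL2]
  filter_upwards [coeFn_restr_contToL2 (w.comp ⟨fun x => -x, continuous_neg⟩)] with x hx
  rw [hx]
  simp

lemma coeFn_evenPart_contToL2 (w : C(Dbl, ℝ)) :
    evenPart (contToL2 w) =ᵐ[unitMeasure] fun x : ℝ => (w x + w (-x : ℝ)) / 2 := by
  have : evenPart (contToL2 w)
      = (1 / 2 : ℝ) • (restr (contToL2 w) + restr (reflect (contToL2 w))) := rfl
  rw [this]
  filter_upwards [coeFn_restr_contToL2 w, coeFn_restr_reflect_contToL2 w,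
    Lp.coeFn_smul (1 / 2 : ℝ) (restr (contToL2 w) + restr (reflect (contToL2 w))),
    Lp.coeFn_add (restr (contToL2 w)) (restr (reflect (contToL2 w)))] with x h1 h2 h3 h4
  rw [h3, Pi.smul_apply, h4, Pi.add_apply, h1, h2, smul_eq_mul]
  ring

lemma coeFn_oddPart_contToL2 (w : C(Dbl, ℝ)) :
    oddPart (contToL2 w) =ᵐ[unitMeasure] fun x : ℝ => (w x - w (-x : ℝ)) / 2 := by
  have : oddPart (contToL2 w)
      = (1 / 2 : ℝ) • (restr (contToL2 w) - restr (reflect (contToL2 w))) := rfl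
  rw [this]
  filter_upwards [coeFn_restr_contToL2 w, coeFn_restr_reflect_contToL2 w,
    Lp.coeFn_smul (1 / 2 : ℝ) (restr (contToL2 w) - restr (reflect (contToL2 w))),
    Lp.coeFn_sub (restr (contToL2 w)) (restr (reflect (contToL2 w)))] with x h1 h2 h3 h4
  rw [h3, Pi.smul_apply, h4, Pi.sub_apply, h1, h2, smul_eq_mul]
  ring

lemma inner_contToL2 (a b : C(Dbl, ℝ)) :
    inner ℝ (contToL2 a) (contToL2 b) = ∫ x in (-1 : ℝ)..1, a x * b x := by
  rw [MeasureTheory.L2.inner_def]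
  have h := AddCircle.intervalIntegral_preimage 2 (-1) (fun x : Dbl => a x * b x)
  norm_num at h
  rw [h]
  refine integral_congr_ae ?_
  filter_upwards [coeFn_contToL2 a, coeFn_contToL2 b] with x h1 h2
  rw [h1, h2]
  simp [mul_comm]

/-- Folding `(-1, 0)` onto `(0, 1)` makes the mixed odd-even products cancel; the factor 2 counts
both halves. -/
lemma inner_contToL2_eq (a b : C(Dbl, ℝ)) :
    inner ℝ (contToL2 a) (contToL2 b)
      = 2 * (inner ℝ (oddPart (contToL2 a)) (oddPart (contToL2 b)) +
          inner ℝ (evenPart (contToL2 a)) (evenPart (contToL2 b))) := by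
  have hc : Continuous (fun t : ℝ => (t : Dbl)) := AddCircle.continuous_mk' 2
  have hab : Continuous fun x : ℝ => a x * b x := by fun_prop
  have hab' : Continuous fun x : ℝ => a (-x : ℝ) * b (-x : ℝ) := by fun_prop
  have h1 : inner ℝ (contToL2 a) (contToL2 b)
      = ∫ x in Ioo (0 : ℝ) 1, (a (-x : ℝ) * b (-x : ℝ) + a x * b x) := by
    rw [inner_contToL2, ← integral_Ioc_eq_integral_Ioo,
      ← intervalIntegral.integral_of_le zero_le_one,
      intervalIntegral.integral_add (hab'.intervalIntegrable _ _) (hab.intervalIntegrable _ _),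
      ← intervalIntegral.integral_add_adjacent_intervals (b := 0)
        (hab.intervalIntegrable _ _) (hab.intervalIntegrable _ _),
      intervalIntegral.integral_comp_neg (fun x : ℝ => a x * b x)]
    simp
  rw [h1, L2.inner_eq_integral, L2.inner_eq_integral,
    ← integral_add (L2.integrable_mul _ (Lp.memLp _)) (L2.integrable_mul _ (Lp.memLp _)),
    ← integral_const_mul]
  refine integral_congr_ae ?_
  filter_upwards [coeFn_oddPart_contToL2 a, coeFn_oddPart_contToL2 b, coeFn_evenPart_contToL2 a,
    coeFn_evenPart_contToL2 b] with x h1 h2 h3 h4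
  rw [h1, h2, h3, h4]
  ring

/-- A continuous function on `[-1,1]` with equal end values lives on the circle. -/
lemma exists_dbl_of_continuousOn {F : ℝ → ℝ} (hF : ContinuousOn F (Icc (-1) 1))
    (h : F (-1) = F 1) : ∃ w : C(Dbl, ℝ), ∀ x ∈ Ico (-1 : ℝ) 1, w x = F x := by
  have e : (-1 + 2 : ℝ) = 1 := by norm_num
  refine ⟨⟨AddCircle.liftIco 2 (-1) F,
    AddCircle.liftIco_continuous (by rw [e]; exact h) (by rw [e]; exact hF)⟩, fun x hx => ?_⟩
  exact AddCircle.liftIco_coe_apply (by rw [e]; exact hx)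

/-! ### Weak derivatives on the circle and orbits of the translation group -/

/-- `Ψ'` is the classical derivative of `Ψ` on the circle. -/
def IsClassicalDeriv (Ψ Ψ' : C(Dbl, ℝ)) : Prop :=
  ∀ x : ℝ, HasDerivAt (fun y : ℝ => Ψ y) (Ψ' x) x

/-- `u` is the weak derivative of `w` on the circle. -/
def IsDblDeriv (w u : L2Dbl) : Prop :=
  ∀ Ψ Ψ' : C(Dbl, ℝ), IsClassicalDeriv Ψ Ψ' →
    inner ℝ w (contToL2 Ψ') = -inner ℝ u (contToL2 Ψ)

lemma continuous_coe_dbl : Continuous (fun t : ℝ => (t : Dbl)) := AddCircle.continuous_mk' 2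

lemma ext_inner_contToL2 {a b : L2Dbl}
    (h : ∀ ψ : C(Dbl, ℝ), inner ℝ a (contToL2 ψ) = inner ℝ b (contToL2 ψ)) : a = b := by
  have hd : DenseRange (contToL2 : C(Dbl, ℝ) → L2Dbl) :=
    ContinuousMap.toLp_denseRange ℝ volume ℝ (by norm_num)
  refine ext_inner_right ℝ fun v => ?_
  have := hd.equalizer (continuous_const.inner continuous_id : Continuous fun v => inner ℝ a v)
    (continuous_const.inner continuous_id : Continuous fun v => inner ℝ b v) (funext fun ψ => h ψ)
  exact congrFun this v

/-- At `x` the averaged translate is the integral of `ψ` over `[x - h, x]`. This turns a translation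
difference into a derivative that a weak derivative can be tested against. -/
lemma isClassicalDeriv_integral_shiftC (ψ : C(Dbl, ℝ)) (h : ℝ) :
    IsClassicalDeriv (∫ s in (0 : ℝ)..h, shiftC (-s) ψ) (ψ - shiftC (-h) ψ) := by
  have hs : Continuous fun s : ℝ => shiftC (-s) ψ :=
    continuous_shiftC.comp (continuous_neg.prodMk continuous_const)
  have hψ : Continuous fun y : ℝ => ψ y := ψ.continuous.comp continuous_coe_dbl
  have e : ∀ x : ℝ, (∫ s in (0 : ℝ)..h, shiftC (-s) ψ) x
      = (∫ y in (0 : ℝ)..x, ψ y) - ∫ y in (0 : ℝ)..(x - h), ψ y := by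
    intro x
    have := ContinuousLinearMap.intervalIntegral_comp_comm
      (ContinuousMap.evalCLM ℝ (x : Dbl)) (hs.intervalIntegrable (μ := volume) 0 h)
    have h2 : (ContinuousMap.evalCLM ℝ (x : Dbl)) (∫ s in (0 : ℝ)..h, shiftC (-s) ψ)
        = (∫ s in (0 : ℝ)..h, shiftC (-s) ψ) x := rfl
    rw [← h2, ← this]
    have h3 : ∀ s : ℝ, (ContinuousMap.evalCLM ℝ (x : Dbl)) (shiftC (-s) ψ)
        = (fun y : ℝ => ψ y) (x - s) := fun s => by
      change ψ ((x : Dbl) + ((-s : ℝ) : Dbl)) = ψ ((x - s : ℝ) : Dbl)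
      rw [← AddCircle.coe_add, sub_eq_add_neg]
    simp_rw [h3]
    rw [intervalIntegral.integral_comp_sub_left (fun y : ℝ => ψ y) x, sub_zero,
      intervalIntegral.integral_interval_sub_left (hψ.intervalIntegrable _ _)
        (hψ.intervalIntegrable _ _)]
  intro x
  simp_rw [e]
  have hd : ∀ x : ℝ, HasDerivAt (fun y => ∫ t in (0 : ℝ)..y, ψ t) (ψ x) x := fun x =>
    intervalIntegral.integral_hasDerivAt_right (hψ.intervalIntegrable _ _)
      (hψ.stronglyMeasurableAtFilter _ _) hψ.continuousAt
  have e2 : (ψ - shiftC (-h) ψ) x = ψ x - ψ (x - h : ℝ) := by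
    change ψ x - ψ ((x : Dbl) + ((-h : ℝ) : Dbl)) = _
    rw [← AddCircle.coe_add, sub_eq_add_neg x h]
  rw [e2]
  exact (hd x).sub ((hd (x - h)).comp_sub_const x h)

lemma continuous_shift_left (u : L2Dbl) : Continuous fun s : ℝ => shift s u :=
  continuous_shift.comp (continuous_id.prodMk continuous_const)

/-- Tested against continuous `ψ`, the translation moves onto `ψ`, and `shiftC (-h) ψ - ψ` is minus
the derivative of an average of translates of `ψ`. Density of continuous functions finishes. -/
lemma IsDblDeriv.shift_sub {w u : L2Dbl} (hw : IsDblDeriv w u) (h : ℝ) :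
    shift h w - w = ∫ s in (0 : ℝ)..h, shift s u := by
  refine ext_inner_contToL2 fun ψ => ?_
  have hs : Continuous fun s : ℝ => shiftC (-s) ψ :=
    continuous_shiftC.comp (continuous_neg.prodMk continuous_const)
  have h1 := hw _ _ (isClassicalDeriv_integral_shiftC ψ h)
  have h2 : inner ℝ u (contToL2 (∫ s in (0 : ℝ)..h, shiftC (-s) ψ))
      = ∫ s in (0 : ℝ)..h, inner ℝ u (contToL2 (shiftC (-s) ψ)) :=
    (ContinuousLinearMap.intervalIntegral_comp_comm ((innerSL ℝ u).comp contToL2)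
      (hs.intervalIntegrable (μ := volume) 0 h)).symm
  have h3 : inner ℝ (∫ s in (0 : ℝ)..h, shift s u) (contToL2 ψ)
      = ∫ s in (0 : ℝ)..h, inner ℝ (contToL2 ψ) (shift s u) := by
    rw [real_inner_comm]
    exact (ContinuousLinearMap.intervalIntegral_comp_comm (innerSL ℝ (contToL2 ψ))
      ((continuous_shift_left u).intervalIntegrable (μ := volume) 0 h)).symm
  have h4 : ∀ s, inner ℝ (contToL2 ψ) (shift s u) = inner ℝ u (contToL2 (shiftC (-s) ψ)) :=
    fun s => by rw [real_inner_comm, inner_shift_left, shift_contToL2]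
  rw [h3]
  simp_rw [h4]
  rw [← h2, inner_sub_left, inner_shift_left, shift_contToL2, ← inner_sub_right,
    ← neg_eq_iff_eq_neg.2 h1, ← inner_neg_right, map_sub, neg_sub]

lemma IsDblDeriv.hasDerivAt_shift {w u : L2Dbl} (hw : IsDblDeriv w u) (t : ℝ) :
    HasDerivAt (fun s => shift s w) (shift t u) t := by
  have hc := continuous_shift_left u
  have e : (fun s => shift s w) = fun s => w + ∫ r in (0 : ℝ)..s, shift r u := by
    funext s
    rw [← hw.shift_sub s]
    abel
  rw [e]
  exact (intervalIntegral.integral_hasDerivAt_right (hc.intervalIntegrable _ _)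
    (hc.stronglyMeasurableAtFilter _ _) hc.continuousAt).const_add w

/-! ### Weak derivatives on the circle and on the interval -/

section Parity

variable {Ψ Ψ' : C(Dbl, ℝ)}

lemma IsClassicalDeriv.hasDerivAt_neg (h : IsClassicalDeriv Ψ Ψ') (x : ℝ) :
    HasDerivAt (fun y : ℝ => Ψ (-y : ℝ)) (-Ψ' (-x : ℝ)) x := by
  have := (h (-x)).comp x (_root_.hasDerivAt_neg x)
  rwa [mul_neg_one] at this

lemma isPrimitive_of_hasDerivAt {c a : ℝ → ℝ} (h : ∀ x, HasDerivAt c (a x) x)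
    (ha : Continuous a) : IsPrimitive c a := by
  have e : deriv c = a := funext fun x => (h x).deriv
  rw [← e]
  refine ContDiff.isPrimitive (contDiff_one_iff_deriv.2 ⟨fun x => (h x).differentiableAt, ?_⟩)
  rwa [e]

lemma IsClassicalDeriv.isPrimitive_even (h : IsClassicalDeriv Ψ Ψ') :
    IsPrimitive (fun x : ℝ => (Ψ x + Ψ (-x : ℝ)) / 2) fun x : ℝ => (Ψ' x - Ψ' (-x : ℝ)) / 2 := by
  have := continuous_coe_dbl
  refine isPrimitive_of_hasDerivAt (fun x => ?_) (by fun_prop)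
  exact ((h x).add (h.hasDerivAt_neg x)).div_const 2

lemma IsClassicalDeriv.isPrimitive_odd (h : IsClassicalDeriv Ψ Ψ') :
    IsPrimitive (fun x : ℝ => (Ψ x - Ψ (-x : ℝ)) / 2) fun x : ℝ => (Ψ' x + Ψ' (-x : ℝ)) / 2 := by
  have := continuous_coe_dbl
  refine isPrimitive_of_hasDerivAt (fun x => ?_) (by fun_prop)
  simpa using ((h x).sub (h.hasDerivAt_neg x)).div_const 2

lemma coe_neg_one_dbl : ((-1 : ℝ) : Dbl) = ((1 : ℝ) : Dbl) := by
  have h : ((-1 + 2 : ℝ) : Dbl) = ((-1 : ℝ) : Dbl) := AddCircle.coe_add_period 2 (-1)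
  rw [← h]
  norm_num

/-- The odd part of `Ψ'` is the derivative of the even part of `Ψ`, which need not vanish at the
ends; this is where `c` must. -/
lemma IsPrimitive.integral_mul_oddPart {c a : ℝ → ℝ} (hc : IsPrimitive c a) (h0 : c 0 = 0)
    (h1 : c 1 = 0) (h : IsClassicalDeriv Ψ Ψ') :
    ∫ x in Ioo (0 : ℝ) 1, c x * oddPart (contToL2 Ψ') x
      = -∫ x in Ioo (0 : ℝ) 1, a x * evenPart (contToL2 Ψ) x := by
  have key := hc.integral_mul h.isPrimitive_even
  rw [h0, h1, zero_mul, zero_mul, sub_zero, zero_sub] at key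
  refine Eq.trans (integral_congr_ae ?_) (key.trans (congrArg _ (integral_congr_ae ?_)))
  · filter_upwards [coeFn_oddPart_contToL2 Ψ'] with x hx
    rw [hx]
  · filter_upwards [coeFn_evenPart_contToL2 Ψ] with x hx
    rw [hx]

/-- No condition on `c` is needed: the odd part of `Ψ` vanishes at 0, and at 1 because `-1` and `1`
are the same point of the circle. Hence `m` carries no boundary condition. -/
lemma IsPrimitive.integral_mul_evenPart {c a : ℝ → ℝ} (hc : IsPrimitive c a)
    (h : IsClassicalDeriv Ψ Ψ') :
    ∫ x in Ioo (0 : ℝ) 1, c x * evenPart (contToL2 Ψ') x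
      = -∫ x in Ioo (0 : ℝ) 1, a x * oddPart (contToL2 Ψ) x := by
  have key := hc.integral_mul h.isPrimitive_odd
  rw [coe_neg_one_dbl, neg_zero, sub_self, sub_self, zero_div, mul_zero, mul_zero, sub_zero,
    zero_sub] at key
  refine Eq.trans (integral_congr_ae ?_) (key.trans (congrArg _ (integral_congr_ae ?_)))
  · filter_upwards [coeFn_evenPart_contToL2 Ψ'] with x hx
    rw [hx]
  · filter_upwards [coeFn_oddPart_contToL2 Ψ] with x hx
    rw [hx]

end Parity

open ContinuousLinearMap in
/-- The weak derivative on the circle of the function with odd part `c` and even part `e`. -/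
lemma isDblDeriv_of_isPrimitive {c e : ℝ → ℝ} {a b : L2} (hc : IsPrimitive c a)
    (he : IsPrimitive e b) (h0 : c 0 = 0) (h1 : c 1 = 0) {w : C(Dbl, ℝ)}
    (ho : oddPart (contToL2 w) =ᵐ[unitMeasure] c) (hev : evenPart (contToL2 w) =ᵐ[unitMeasure] e) :
    -- The adjoints of the parity maps are half the odd and even extensions, whence the factor 2.
    IsDblDeriv (contToL2 w) ((2 : ℝ) • (adjoint oddPart b + adjoint evenPart a)) := by
  intro Ψ Ψ' h
  rw [inner_contToL2_eq, inner_smul_left, inner_add_left, adjoint_inner_left, adjoint_inner_left,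
    L2.inner_eq_integral, L2.inner_eq_integral, L2.inner_eq_integral, L2.inner_eq_integral]
  have e1 : ∫ x in Ioo (0 : ℝ) 1, oddPart (contToL2 w) x * oddPart (contToL2 Ψ') x
      = ∫ x in Ioo (0 : ℝ) 1, c x * oddPart (contToL2 Ψ') x := by
    refine integral_congr_ae ?_
    filter_upwards [ho] with x hx
    rw [hx]
  have e2 : ∫ x in Ioo (0 : ℝ) 1, evenPart (contToL2 w) x * evenPart (contToL2 Ψ') x
      = ∫ x in Ioo (0 : ℝ) 1, e x * evenPart (contToL2 Ψ') x := by
    refine integral_congr_ae ?_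
    filter_upwards [hev] with x hx
    rw [hx]
  rw [e1, e2, hc.integral_mul_oddPart h0 h1 h, he.integral_mul_evenPart h]
  simp
  ring

lemma IsTestFunction.integral_toLp_mul {φ : ℝ → ℝ} (hφ : IsTestFunction φ) (v : L2) :
    inner ℝ (hφ.memLp.toLp φ) v = ∫ x in Ioo (0 : ℝ) 1, φ x * v x := by
  rw [L2.inner_eq_integral]
  refine integral_congr_ae ?_
  filter_upwards [hφ.memLp.coeFn_toLp] with x hx
  rw [hx]

lemma IsTestFunction.integral_toLp_deriv_mul {φ : ℝ → ℝ} (hφ : IsTestFunction φ) (v : L2) :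
    inner ℝ (hφ.memLp_deriv.toLp _) v = ∫ x in Ioo (0 : ℝ) 1, deriv φ x * v x := by
  rw [L2.inner_eq_integral]
  refine integral_congr_ae ?_
  filter_upwards [hφ.memLp_deriv.coeFn_toLp] with x hx
  rw [hx]

open ContinuousLinearMap in
lemma IsTestFunction.isDblDeriv_odd {φ : ℝ → ℝ} (hφ : IsTestFunction φ) :
    IsDblDeriv (adjoint oddPart (hφ.memLp.toLp φ)) (adjoint evenPart (hφ.memLp_deriv.toLp _)) := by
  intro Ψ Ψ' h
  rw [adjoint_inner_left, adjoint_inner_left, hφ.integral_toLp_mul, hφ.integral_toLp_deriv_mul]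
  exact hφ.isPrimitive.integral_mul_oddPart (hφ.eq_zero (by simp)) (hφ.eq_zero (by simp)) h

open ContinuousLinearMap in
lemma IsTestFunction.isDblDeriv_even {φ : ℝ → ℝ} (hφ : IsTestFunction φ) :
    IsDblDeriv (adjoint evenPart (hφ.memLp.toLp φ)) (adjoint oddPart (hφ.memLp_deriv.toLp _)) := by
  intro Ψ Ψ' h
  rw [adjoint_inner_left, adjoint_inner_left, hφ.integral_toLp_mul, hφ.integral_toLp_deriv_mul]
  exact hφ.isPrimitive.integral_mul_evenPart h

lemma isWeakDeriv_iff_inner {u v : L2} :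
    IsWeakDeriv u v ↔ ∀ φ (hφ : IsTestFunction φ),
      inner ℝ u (hφ.memLp_deriv.toLp _) = -inner ℝ v (hφ.memLp.toLp φ) := by
  refine forall₂_congr fun φ hφ => ?_
  rw [real_inner_comm, real_inner_comm _ v, hφ.integral_toLp_deriv_mul, hφ.integral_toLp_mul]
  simp only [mul_comm]

/-- Test functions on the interval transfer to the circle through the adjoints of the parity maps,
which are half the odd and even extensions. -/
lemma isWeakDeriv_evenPart {w u : L2Dbl}
    (h : ∀ Φ Φ', IsDblDeriv Φ Φ' → inner ℝ w Φ' = -inner ℝ u Φ) :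
    IsWeakDeriv (evenPart w) (oddPart u) := by
  refine isWeakDeriv_iff_inner.2 fun φ hφ => ?_
  have := h _ _ hφ.isDblDeriv_odd
  rwa [ContinuousLinearMap.adjoint_inner_right, ContinuousLinearMap.adjoint_inner_right] at this

lemma isWeakDeriv_oddPart {w u : L2Dbl}
    (h : ∀ Φ Φ', IsDblDeriv Φ Φ' → inner ℝ w Φ' = -inner ℝ u Φ) :
    IsWeakDeriv (oddPart w) (evenPart u) := by
  refine isWeakDeriv_iff_inner.2 fun φ hφ => ?_
  have := h _ _ hφ.isDblDeriv_even
  rwa [ContinuousLinearMap.adjoint_inner_right, ContinuousLinearMap.adjoint_inner_right] at this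

/-! ### The nonlinear equation in the moving frame -/

/-- The superposition operator `w ↦ d (M + w_even) - k` on continuous functions on the circle. -/
def nonlin {d : ℝ → ℝ} (hd : Continuous d) (M : C(Dbl, ℝ)) (k : ℝ) (w : C(Dbl, ℝ)) : C(Dbl, ℝ) :=
  ⟨fun x => d (M x + (w x + w (-x)) / 2) - k, by fun_prop⟩

@[simp] lemma nonlin_apply {d : ℝ → ℝ} (hd : Continuous d) (M : C(Dbl, ℝ)) (k : ℝ) (w : C(Dbl, ℝ))
    (x : Dbl) : nonlin hd M k w x = d (M x + (w x + w (-x)) / 2) - k := rfl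

/-- The superposition operator in the moving frame. -/
def nonlinShift {d : ℝ → ℝ} (hd : Continuous d) (M : C(Dbl, ℝ)) (k t : ℝ) (v : C(Dbl, ℝ)) :
    C(Dbl, ℝ) :=
  -shiftC t (nonlin hd M k (shiftC (-t) v))

lemma nonlinShift_apply {d : ℝ → ℝ} (hd : Continuous d) (M : C(Dbl, ℝ)) (k t : ℝ) (v : C(Dbl, ℝ))
    (x : Dbl) : nonlinShift hd M k t v x
      = -(d (M (x + t) + (v x + v (-(x + t) + (-t : ℝ))) / 2) - k) := by
  simp [nonlinShift]

open scoped NNReal in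
lemma lipschitzWith_nonlinShift {d : ℝ → ℝ} {L : ℝ≥0} (hL : LipschitzWith L d) (M : C(Dbl, ℝ))
    (k t : ℝ) : LipschitzWith L (nonlinShift hL.continuous M k t) := by
  refine LipschitzWith.of_dist_le_mul fun v v' => ?_
  refine (ContinuousMap.dist_le (by positivity)).2 fun x => ?_
  rw [nonlinShift_apply, nonlinShift_apply, dist_neg_neg, dist_sub_right]
  refine (hL.dist_le_mul _ _).trans ?_
  gcongr
  have h1 := ContinuousMap.dist_apply_le_dist (f := v) (g := v') x
  have h2 := ContinuousMap.dist_apply_le_dist (f := v) (g := v') (-(x + t) + (-t : ℝ))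
  rw [Real.dist_eq, abs_le] at h1 h2 ⊢
  constructor <;> linarith [h1.1, h1.2, h2.1, h2.2]

lemma continuous_nonlin {d : ℝ → ℝ} (hd : Continuous d) (M : C(Dbl, ℝ)) (k : ℝ) :
    Continuous (nonlin hd M k) := by
  refine ContinuousMap.continuous_of_continuous_uncurry _ ?_
  change Continuous fun z : C(Dbl, ℝ) × Dbl => d (M z.2 + (z.1 z.2 + z.1 (-z.2)) / 2) - k
  fun_prop

lemma continuous_nonlinShift {d : ℝ → ℝ} (hd : Continuous d) (M : C(Dbl, ℝ)) (k : ℝ)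
    (v : C(Dbl, ℝ)) : Continuous fun t => nonlinShift hd M k t v := by
  have h1 : Continuous fun t : ℝ => shiftC (-t) v :=
    continuous_shiftC.comp (continuous_neg.prodMk continuous_const)
  exact (continuous_shiftC.comp
    (continuous_id.prodMk ((continuous_nonlin hd M k).comp h1))).neg

/-- The increment of `d` is `θ (a + b) / 2` with `0 ≤ θ ≤ L`, so `a` and `b` enter with weights `L -
θ / 2` and `-θ / 2`, of total size `L`. Monotonicity thus prevents exponential growth in the maximum
principle. -/
lemma abs_mul_sub_le_of_monotone {d : ℝ → ℝ} {L : NNReal} (hL : LipschitzWith L d)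
    (hm : Monotone d) {s a b n k C : ℝ} (ha : |a| ≤ n) (hb : |b| ≤ n) (hC : |d s - k| ≤ C) :
    |L * a - (d (s + (a + b) / 2) - k)| ≤ L * n + C := by
  have h := hL.dist_le_mul (s + (a + b) / 2) s
  have hL0 : (0 : ℝ) ≤ L := L.2
  rw [Real.dist_eq, Real.dist_eq, add_sub_cancel_left] at h
  rw [abs_le] at ha hb hC ⊢
  have p1 := mul_le_mul_of_nonneg_left ha.1 hL0
  have p2 := mul_le_mul_of_nonneg_left ha.2 hL0
  have p3 := mul_le_mul_of_nonneg_left hb.1 hL0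
  have p4 := mul_le_mul_of_nonneg_left hb.2 hL0
  rcases le_total 0 ((a + b) / 2) with hx | hx
  · have h0 : d s ≤ d (s + (a + b) / 2) := hm (by linarith)
    rw [abs_of_nonneg hx, abs_of_nonneg (by linarith)] at h
    constructor <;> linarith
  · have h0 : d (s + (a + b) / 2) ≤ d s := hm (by linarith)
    rw [abs_of_nonpos hx, abs_of_nonpos (by linarith)] at h
    constructor <;> linarith

/-- Maximum principle in the moving frame. -/
lemma norm_le_of_hasDerivAt_nonlinShift {d : ℝ → ℝ} {L : NNReal} (hL : LipschitzWith L d)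
    (hm : Monotone d) {M : C(Dbl, ℝ)} {k C T : ℝ} (hC : ∀ x, |d (M x) - k| ≤ C)
    {v : ℝ → C(Dbl, ℝ)}
    (hv : ∀ t ∈ Icc 0 T, HasDerivAt v (nonlinShift hL.continuous M k t (v t)) t) :
    ∀ t ∈ Icc 0 T, ‖v t‖ ≤ ‖v 0‖ + (C + 1) * t := by
  have hexp : ∀ t : ℝ, HasDerivAt (fun t : ℝ => Real.exp (L * t)) (Real.exp (L * t) * L) t :=
    fun t => by simpa using ((hasDerivAt_id t).const_mul (L : ℝ)).exp
  have hu : ∀ t ∈ Icc 0 T, HasDerivAt (fun t => Real.exp (L * t) • v t)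
      (Real.exp (L * t) • nonlinShift hL.continuous M k t (v t) +
        (Real.exp (L * t) * L) • v t) t :=
    fun t ht => (hexp t).smul (hv t ht)
  have hB : ∀ t, HasDerivAt (fun t => Real.exp (L * t) * (‖v 0‖ + (C + 1) * t))
      (Real.exp (L * t) * L * (‖v 0‖ + (C + 1) * t) + Real.exp (L * t) * (C + 1)) t := fun t =>
    (hexp t).mul (by simpa using ((hasDerivAt_id t).const_mul (C + 1)).const_add ‖v 0‖)
  have key := image_norm_le_of_norm_deriv_right_lt_deriv_boundary (a := 0) (b := T)
    (f := fun t => Real.exp (L * t) • v t)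
    (fun t ht => (hu t ht).continuousAt.continuousWithinAt)
    (fun t ht => (hu t (Ico_subset_Icc_self ht)).hasDerivWithinAt) (by simp) hB
    (fun t ht heq => by
      have hpos := Real.exp_pos (L * t)
      have hn : ‖v t‖ = ‖v 0‖ + (C + 1) * t := by
        rw [norm_smul, Real.norm_of_nonneg hpos.le] at heq
        exact mul_left_cancel₀ hpos.ne' heq
      have e : Real.exp (L * t) • nonlinShift hL.continuous M k t (v t) +
        (Real.exp (L * t) * L) • v t = Real.exp (L * t) •
          ((L : ℝ) • v t + nonlinShift hL.continuous M k t (v t)) := by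
        rw [smul_add, smul_smul, add_comm]
      have hle : ‖(L : ℝ) • v t + nonlinShift hL.continuous M k t (v t)‖ ≤ L * ‖v t‖ + C := by
        have hC0 : 0 ≤ C := (abs_nonneg _).trans (hC 0)
        refine (ContinuousMap.norm_le _ (by positivity)).2 fun x => ?_
        have := abs_mul_sub_le_of_monotone hL hm ((v t).norm_coe_le_norm x)
          ((v t).norm_coe_le_norm (-(x + t) + (-t : ℝ))) (hC (x + t))
        rwa [ContinuousMap.add_apply, nonlinShift_apply, ← sub_eq_add_neg, ContinuousMap.smul_apply,
          smul_eq_mul]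
      rw [e, norm_smul, Real.norm_of_nonneg hpos.le, ← hn]
      nlinarith [mul_le_mul_of_nonneg_left hle hpos.le])
  intro t ht
  have := key ht
  rw [norm_smul, Real.norm_of_nonneg (Real.exp_pos _).le] at this
  exact le_of_mul_le_mul_left this (Real.exp_pos _)

/-- Global solvability in the moving frame for continuous data. -/
theorem exists_hasDerivAt_nonlinShift {d : ℝ → ℝ} (hd : ContDiff ℝ 1 d) (hm : Monotone d)
    (M : C(Dbl, ℝ)) (k : ℝ) (w₀ : C(Dbl, ℝ)) {T : ℝ} (hT : 0 ≤ T) :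
    ∃ v : ℝ → C(Dbl, ℝ), Continuous v ∧ v 0 = w₀ ∧
      ∀ t ∈ Icc 0 T, HasDerivAt v (nonlinShift hd.continuous M k t (v t)) t := by
  set C := ‖nonlin hd.continuous M k 0‖ with hCdef
  have hC : ∀ x, |d (M x) - k| ≤ C := fun x => by
    have := (nonlin hd.continuous M k 0).norm_coe_le_norm x
    simpa using this
  -- The a priori bound at time `T`. It does not involve the Lipschitz constant of the truncation,
  -- so cutting `d` off at `K = ‖M‖ + R` is not circular.
  set R := ‖w₀‖ + (C + 1) * T with hR
  have hC0 : 0 ≤ C := norm_nonneg _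
  have hR0 : 0 ≤ R := by positivity
  set K := ‖M‖ + R with hK
  have hK0 : -K ≤ K := by
    have : 0 ≤ K := by positivity
    linarith
  obtain ⟨B, hB⟩ := (isCompact_Icc (a := -K) (b := K)).exists_bound_of_continuousOn
    (hd.continuous_deriv le_rfl).continuousOn
  have hlip : LipschitzOnWith B.toNNReal d (Icc (-K) K) :=
    (convex_Icc (-K) K).lipschitzOnWith_of_nnnorm_deriv_le
      (fun x _ => (hd.differentiable one_ne_zero).differentiableAt) fun x hx => by
        rw [← NNReal.coe_le_coe, coe_nnnorm]
        exact (hB x hx).trans (Real.le_coe_toNNReal B)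
  set D : ℝ → ℝ := fun s => d (projIcc (-K) K hK0 s) with hD
  have hDL : LipschitzWith B.toNNReal D := by
    have h1 : LipschitzWith B.toNNReal fun s : Icc (-K) K => d s := hlip.to_restrict
    have h2 := h1.comp (LipschitzWith.projIcc hK0)
    rwa [mul_one] at h2
  have hDm : Monotone D := fun a b hab => hm (monotone_projIcc hK0 hab)
  have hDd : ∀ s, |s| ≤ K → D s = d s := fun s hs => by
    simp only [hD]
    rw [projIcc_of_mem hK0 (abs_le.1 hs)]
  have hMK : ∀ x, |M x| ≤ ‖M‖ := fun x => M.norm_coe_le_norm x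
  obtain ⟨v, hvc, hv0, hv⟩ := exists_forall_hasDerivAt_of_lipschitzWith
    (fun t => lipschitzWith_nonlinShift hDL M k t)
    (continuous_nonlinShift hDL.continuous M k) w₀ hT
  have hbd := norm_le_of_hasDerivAt_nonlinShift hDL hDm (C := C) (fun x => by
    rw [hDd _ ((hMK x).trans (by linarith))]
    exact hC x) hv
  refine ⟨v, hvc, hv0, fun t ht => ?_⟩
  have hvR : ‖v t‖ ≤ R := by
    refine (hbd t ht).trans ?_
    rw [hv0, hR]
    gcongr
    exact ht.2
  have e : nonlinShift hd.continuous M k t (v t) = nonlinShift hDL.continuous M k t (v t) := by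
    ext x
    rw [nonlinShift_apply, nonlinShift_apply, hDd]
    have h1 := hMK (x + t)
    have h2 := ((v t).norm_coe_le_norm x).trans hvR
    have h3 := ((v t).norm_coe_le_norm (-(x + t) + (-t : ℝ))).trans hvR
    rw [Real.norm_eq_abs] at h2 h3
    rw [abs_le] at h1 h2 h3 ⊢
    constructor <;> linarith [h1.1, h1.2, h2.1, h2.2, h3.1, h3.2]
  rw [e]
  exact hv t ht

/-! ### Linearisation of the superposition operator -/

/-- The even part of a continuous function on the circle. -/
def evenC (w : C(Dbl, ℝ)) : C(Dbl, ℝ) := ⟨fun x => (w x + w (-x)) / 2, by fun_prop⟩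

@[simp] lemma evenC_apply (w : C(Dbl, ℝ)) (x : Dbl) : evenC w x = (w x + w (-x)) / 2 := rfl

lemma evenProj_apply (u : L2Dbl) : evenProj u = (1 / 2 : ℝ) • (u + reflect u) := rfl

lemma evenProj_contToL2 (w : C(Dbl, ℝ)) : evenProj (contToL2 w) = contToL2 (evenC w) := by
  rw [evenProj_apply, reflect_contToL2, ← map_add, ← map_smul]
  congr 1
  ext x
  simp
  ring

lemma norm_evenProj_le (u : L2Dbl) : ‖evenProj u‖ ≤ ‖u‖ := by
  rw [evenProj_apply, norm_smul]
  have := norm_add_le u (reflect u)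
  rw [LinearIsometry.norm_map] at this
  norm_num
  linarith

/-- Multiplication of square-integrable functions by continuous functions. -/
def mulC : C(Dbl, ℝ) →L[ℝ] L2Dbl →L[ℝ] L2Dbl :=
  ((ContinuousLinearMap.mul ℝ ℝ).holderL volume ⊤ 2 2).comp (ContinuousMap.toLp ⊤ volume ℝ)

lemma coeFn_mulC (q : C(Dbl, ℝ)) (u : L2Dbl) : mulC q u =ᵐ[volume] fun x => q x * u x := by
  have h1 : mulC q u = (ContinuousLinearMap.mul ℝ ℝ).holder 2 (ContinuousMap.toLp ⊤ volume ℝ q) u :=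
    rfl
  rw [h1]
  filter_upwards [(ContinuousLinearMap.mul ℝ ℝ).coeFn_holder (r := 2)
    (ContinuousMap.toLp ⊤ volume ℝ q) u,
    ContinuousMap.coeFn_toLp (p := ⊤) (𝕜 := ℝ) volume q] with x h2 h3
  rw [h2, h3]
  rfl

lemma norm_mulC_le (q : C(Dbl, ℝ)) (u : L2Dbl) : ‖mulC q u‖ ≤ ‖q‖ * ‖u‖ := by
  refine Lp.norm_le_mul_norm_of_ae_le_mul ?_
  filter_upwards [coeFn_mulC q u] with x hx
  rw [hx, norm_mul]
  gcongr
  exact q.norm_coe_le_norm x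

lemma mulC_contToL2 (q w : C(Dbl, ℝ)) : mulC q (contToL2 w) = contToL2 (q * w) := by
  refine Lp.ext ?_
  filter_upwards [coeFn_mulC q (contToL2 w), coeFn_contToL2 w, coeFn_contToL2 (q * w)]
    with x h1 h2 h3
  rw [h1, h2, h3]
  rfl

lemma norm_contToL2_le_of_forall {a b : C(Dbl, ℝ)} {η : ℝ} (h : ∀ x, |a x| ≤ η * |b x|) :
    ‖contToL2 a‖ ≤ η * ‖contToL2 b‖ := by
  refine Lp.norm_le_mul_norm_of_ae_le_mul ?_
  filter_upwards [coeFn_contToL2 a, coeFn_contToL2 b] with x h1 h2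
  rw [h1, h2]
  exact h x

/-- A continuously differentiable function is uniformly differentiable on bounded sets. -/
lemma ContDiff.exists_abs_sub_sub_le {d : ℝ → ℝ} (hd : ContDiff ℝ 1 d) (A : ℝ) {η : ℝ}
    (hη : 0 < η) : ∃ δ > 0, ∀ a k, |a| ≤ A → |k| ≤ δ →
      |d (a + k) - d a - deriv d a * k| ≤ η * |k| := by
  have hu := isCompact_Icc.uniformContinuousOn_of_continuous
    (hd.continuous_deriv le_rfl).continuousOn (s := Icc (-(A + 1)) (A + 1))
  obtain ⟨δ, hδ, h⟩ := Metric.uniformContinuousOn_iff_le.1 hu η hη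
  -- The cap 1 keeps the segment from `a` to `a + k` inside `[-(A + 1), A + 1]`, where `d'` is
  -- uniformly continuous.
  refine ⟨min δ 1, by positivity, fun a k ha hk => ?_⟩
  have hk1 : |k| ≤ δ := hk.trans (min_le_left _ _)
  have hk2 : |k| ≤ 1 := hk.trans (min_le_right _ _)
  have hmem : ∀ s ∈ uIcc a (a + k), |s - a| ≤ |k| := fun s hs => by
    have := abs_sub_left_of_mem_uIcc hs
    rwa [add_sub_cancel_left] at this
  have ha' := abs_le.1 ha
  have key := (convex_uIcc a (a + k)).norm_image_sub_le_of_norm_hasDerivWithin_le (C := η)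
    (f := fun s => d s - deriv d a * s) (f' := fun s => deriv d s - deriv d a)
    (fun s _ => by
      have := ((hd.differentiable one_ne_zero) s).hasDerivAt.sub
        ((hasDerivAt_id s).const_mul (deriv d a))
      rw [mul_one] at this
      exact this.hasDerivWithinAt)
    (fun s hs => by
      have h1 := hmem s hs
      have h2 := abs_le.1 (h1.trans hk2)
      rw [← dist_eq_norm]
      refine h s ⟨by linarith, by linarith⟩ a ⟨by linarith, by linarith⟩ ?_
      rw [Real.dist_eq]
      exact h1.trans hk1) left_mem_uIcc right_mem_uIcc
  rw [Real.norm_eq_abs, add_sub_cancel_left, Real.norm_eq_abs] at key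
  convert key using 2
  ring

/-- The derivative `d' (M + w_even)` of the superposition operator. -/
def nonlinDeriv {d : ℝ → ℝ} (hd : ContDiff ℝ 1 d) (M w : C(Dbl, ℝ)) : C(Dbl, ℝ) :=
  ⟨fun x => deriv d (M x + (w x + w (-x)) / 2), by
    have := hd.continuous_deriv le_rfl
    fun_prop⟩

lemma continuous_nonlinDeriv {d : ℝ → ℝ} (hd : ContDiff ℝ 1 d) (M : C(Dbl, ℝ)) :
    Continuous (nonlinDeriv hd M) := by
  have := hd.continuous_deriv le_rfl
  refine ContinuousMap.continuous_of_continuous_uncurry _ ?_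
  change Continuous fun z : C(Dbl, ℝ) × Dbl => deriv d (M z.2 + (z.1 z.2 + z.1 (-z.2)) / 2)
  fun_prop

/-- Differentiability of the superposition operator in the two norms `‖·‖_∞`, `‖·‖_2`. -/
lemma exists_norm_nonlin_sub_le {d : ℝ → ℝ} (hd : ContDiff ℝ 1 d) (M : C(Dbl, ℝ)) (k A : ℝ) {η : ℝ}
    (hη : 0 < η) : ∃ δ > 0, ∀ w w' : C(Dbl, ℝ), ‖w‖ ≤ A → ‖w' - w‖ ≤ δ →
      ‖contToL2 (nonlin hd.continuous M k w') - contToL2 (nonlin hd.continuous M k w) -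
        mulC (nonlinDeriv hd M w) (evenProj (contToL2 w' - contToL2 w))‖
        ≤ η * ‖contToL2 w' - contToL2 w‖ := by
  obtain ⟨δ, hδ, h⟩ := hd.exists_abs_sub_sub_le (‖M‖ + A) hη
  refine ⟨δ, hδ, fun w w' hw hw' => ?_⟩
  have hle : ‖evenProj (contToL2 w' - contToL2 w)‖ ≤ ‖contToL2 w' - contToL2 w‖ :=
    norm_evenProj_le _
  refine le_trans ?_ (mul_le_mul_of_nonneg_left hle hη.le)
  -- All terms are now images of continuous functions, so a pointwise Taylor estimate, valid by
  -- sup-norm smallness, integrates to the `L²` bound.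
  rw [← map_sub, ← map_sub, evenProj_contToL2, mulC_contToL2, ← map_sub]
  refine norm_contToL2_le_of_forall fun x => ?_
  have h1 := M.norm_coe_le_norm x
  have h2 := (w.norm_coe_le_norm x).trans hw
  have h3 := (w.norm_coe_le_norm (-x)).trans hw
  have h4 := ((w' - w).norm_coe_le_norm x).trans hw'
  have h5 := ((w' - w).norm_coe_le_norm (-x)).trans hw'
  rw [Real.norm_eq_abs, abs_le] at h1 h2 h3 h4 h5
  have := h (M x + (w x + w (-x)) / 2) (evenC (w' - w) x)
    (abs_le.2 ⟨by linarith [h1.1, h2.1, h3.1], by linarith [h1.2, h2.2, h3.2]⟩)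
    (by rw [evenC_apply, abs_le]; constructor <;> linarith [h4.1, h5.1, h4.2, h5.2])
  convert this using 2
  simp only [ContinuousMap.sub_apply, ContinuousMap.mul_apply, nonlin_apply, evenC_apply,
    nonlinDeriv, ContinuousMap.coe_mk]
  rw [show M x + (w' x + w' (-x)) / 2
    = M x + (w x + w (-x)) / 2 + (w' x - w x + (w' (-x) - w (-x))) / 2 by ring]
  ring

/-! ### Time regularity by difference quotients -/

section TimeRegularity

open Filter Topology

/-- The curve in `L²` obtained by translating `v t` from the moving frame back to the fixed one. -/
def movingToL2 (v : ℝ → C(Dbl, ℝ)) (t : ℝ) : L2Dbl := contToL2 (shiftC (-t) (v t))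

lemma movingToL2_eq (v : ℝ → C(Dbl, ℝ)) (t : ℝ) :
    movingToL2 v t = shift (-t) (contToL2 (v t)) := (shift_contToL2 _ _).symm

lemma continuous_shiftC_neg {v : ℝ → C(Dbl, ℝ)} (hv : Continuous v) :
    Continuous fun t => shiftC (-t) (v t) :=
  continuous_shiftC.comp (continuous_neg.prodMk hv)

lemma continuous_movingToL2 {v : ℝ → C(Dbl, ℝ)} (hv : Continuous v) : Continuous (movingToL2 v) :=
  contToL2.continuous.comp (continuous_shiftC_neg hv)

lemma contToL2_nonlinShift {d : ℝ → ℝ} (hd : Continuous d) (M : C(Dbl, ℝ)) (k t : ℝ)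
    (v : C(Dbl, ℝ)) : contToL2 (nonlinShift hd M k t v)
      = -shift t (contToL2 (nonlin hd M k (shiftC (-t) v))) := by
  rw [shift_contToL2, ← map_neg]
  rfl

/-- The linearised equation, in the moving frame, has a solution in `L²`. -/
lemma exists_hasDerivAt_linearized {q : ℝ → C(Dbl, ℝ)} (hq : Continuous q) (z₀ : L2Dbl) {T : ℝ}
    (hT : 0 ≤ T) : ∃ ζ : ℝ → L2Dbl, Continuous ζ ∧ ζ 0 = z₀ ∧ ∀ t ∈ Icc 0 T,
      HasDerivAt ζ (-shift t (mulC (q t) (evenProj (shift (-t) (ζ t))))) t := by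
  -- The coefficient is bounded only on `[0, T]`; freezing it outside gives a Lipschitz constant
  -- valid at all times.
  obtain ⟨Q, hQ⟩ := (isCompact_Icc (a := (0 : ℝ)) (b := T)).exists_bound_of_continuousOn
    hq.continuousOn
  set q' : ℝ → C(Dbl, ℝ) := fun t => q (projIcc 0 T hT t) with hq'
  have hq'c : Continuous q' := hq.comp (continuous_subtype_val.comp continuous_projIcc)
  have hlip : ∀ t, LipschitzWith Q.toNNReal fun u : L2Dbl =>
      -shift t (mulC (q' t) (evenProj (shift (-t) u))) := by
    intro t
    refine LipschitzWith.of_dist_le_mul fun u u' => ?_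
    rw [dist_neg_neg, (shift t).dist_map, dist_eq_norm, ← map_sub, ← map_sub, ← map_sub]
    refine (norm_mulC_le _ _).trans ?_
    rw [dist_eq_norm]
    have h1 := norm_evenProj_le (shift (-t) (u - u'))
    rw [LinearIsometry.norm_map] at h1
    gcongr
    exact (hQ _ (projIcc 0 T hT t).2).trans (Real.le_coe_toNNReal Q)
  have hcont : ∀ u : L2Dbl, Continuous fun t => -shift t (mulC (q' t) (evenProj (shift (-t) u))) := by
    intro u
    have h1 : Continuous fun t : ℝ => evenProj (shift (-t) u) :=
      evenProj.continuous.comp ((continuous_shift_left u).comp continuous_neg)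
    have h2 : Continuous fun t : ℝ => mulC (q' t) (evenProj (shift (-t) u)) :=
      (mulC.continuous.comp hq'c).clm_apply h1
    exact (continuous_shift.comp (continuous_id.prodMk h2)).neg
  obtain ⟨ζ, hζc, hζ0, hζ⟩ := exists_forall_hasDerivAt_of_lipschitzWith hlip hcont z₀ hT
  refine ⟨ζ, hζc, hζ0, fun t ht => ?_⟩
  have := hζ t ht
  simp only [hq', projIcc_of_mem hT ht] at this
  exact this

section Regularity

variable {d : ℝ → ℝ} (hd : ContDiff ℝ 1 d) {M : C(Dbl, ℝ)} {k T : ℝ} {v : ℝ → C(Dbl, ℝ)}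
  {u₀ : L2Dbl} {ζ : ℝ → L2Dbl}

/-- The error of the difference quotient of the solution, in the moving frame. -/
def quotientError (v : ℝ → C(Dbl, ℝ)) (ζ : ℝ → L2Dbl) (h t : ℝ) : L2Dbl :=
  h⁻¹ • (shift (-h) (contToL2 (v (t + h))) - contToL2 (v t)) - ζ t

lemma shift_neg_quotientError_add (h t : ℝ) :
    shift (-t) (quotientError v ζ h t + ζ t) = h⁻¹ • (movingToL2 v (t + h) - movingToL2 v t) := by
  rw [quotientError, sub_add_cancel, map_smul, map_sub, shift_shift, movingToL2_eq, movingToL2_eq,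
    neg_add]

/-- The quotient splits into a translated slope of `v` and the slope of the translation orbit of `v
0`. The latter converges because `v 0` has a weak derivative; the value of `ζ 0` is `∂ₜw(0)` as read
off from the equation. -/
lemma tendsto_quotientError_zero (hv0 : HasDerivAt v (nonlinShift hd.continuous M k 0 (v 0)) 0)
    (hu : IsDblDeriv (contToL2 (v 0)) u₀)
    (hζ0 : ζ 0 = -u₀ - contToL2 (nonlin hd.continuous M k (v 0))) :
    Tendsto (fun h => quotientError v ζ h 0) (𝓝[>] 0) (𝓝 0) := by
  have hz : shiftC (-0) (v 0) = v 0 := by ext; simp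
  have h1 : HasDerivAt (fun t => contToL2 (v t)) (contToL2 (nonlinShift hd.continuous M k 0 (v 0)))
      0 := contToL2.hasFDerivAt.comp_hasDerivAt 0 hv0
  have h2 := (hasDerivAt_iff_tendsto_slope_zero.1 h1).mono_left
    (nhdsWithin_mono 0 fun x (hx : x ∈ Ioi (0 : ℝ)) => (ne_of_gt hx : x ≠ 0))
  have h3 : Tendsto (fun h : ℝ => -h) (𝓝[>] 0) (𝓝 0) := by
    have : Tendsto (fun h : ℝ => -h) (𝓝 0) (𝓝 (-0)) := continuous_neg.tendsto 0
    rw [neg_zero] at this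
    exact this.mono_left nhdsWithin_le_nhds
  have h4 := (continuous_shift.tendsto
    (0, contToL2 (nonlinShift hd.continuous M k 0 (v 0)))).comp (h3.prodMk_nhds h2)
  have h5 : HasDerivAt (fun t : ℝ => shift (-t) (contToL2 (v 0))) (-u₀) 0 := by
    have := (hu.hasDerivAt_shift (-0)).scomp (0 : ℝ) (hasDerivAt_neg (0 : ℝ))
    simpa [shift_zero, Function.comp_def] using this
  have h6 := (hasDerivAt_iff_tendsto_slope_zero.1 h5).mono_left
    (nhdsWithin_mono 0 fun x (hx : x ∈ Ioi (0 : ℝ)) => (ne_of_gt hx : x ≠ 0))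
  have h7 := (h4.add h6).sub_const (ζ 0)
  have e : shift 0 (contToL2 (nonlinShift hd.continuous M k 0 (v 0))) + -u₀ - ζ 0 = 0 := by
    rw [hζ0, contToL2_nonlinShift, shift_zero, shift_zero, hz]
    abel
  simp only [e] at h7
  refine h7.congr fun h => ?_
  simp only [Function.comp, quotientError, zero_add, neg_zero, shift_zero]
  rw [map_smul, ← smul_add, map_sub]
  congr 2
  abel

lemma hasDerivAt_quotientError {h t : ℝ}
    (hvt : HasDerivAt v (nonlinShift hd.continuous M k t (v t)) t)
    (hvh : HasDerivAt v (nonlinShift hd.continuous M k (t + h) (v (t + h))) (t + h))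
    (hζ : HasDerivAt ζ (-shift t (mulC (nonlinDeriv hd M (shiftC (-t) (v t)))
      (evenProj (shift (-t) (ζ t))))) t) :
    HasDerivAt (quotientError v ζ h)
      (-shift t (h⁻¹ • (contToL2 (nonlin hd.continuous M k (shiftC (-(t + h)) (v (t + h)))) -
        contToL2 (nonlin hd.continuous M k (shiftC (-t) (v t)))) -
        mulC (nonlinDeriv hd M (shiftC (-t) (v t))) (evenProj (shift (-t) (ζ t))))) t := by
  have h1 : HasDerivAt (fun t => contToL2 (v t)) _ t := contToL2.hasFDerivAt.comp_hasDerivAt t hvt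
  have h2 : HasDerivAt (fun t => contToL2 (v (t + h))) _ t :=
    contToL2.hasFDerivAt.comp_hasDerivAt t (hvh.comp_add_const t h)
  have h3 : HasDerivAt (fun t => shift (-h) (contToL2 (v (t + h)))) _ t :=
    (shift (-h)).toContinuousLinearMap.hasFDerivAt.comp_hasDerivAt t h2
  have h4 := ((h3.sub h1).const_smul h⁻¹).sub hζ
  refine h4.congr_deriv ?_
  rw [contToL2_nonlinShift, contToL2_nonlinShift, LinearIsometry.coe_toContinuousLinearMap, map_neg,
    shift_shift, show -h + (t + h) = t by ring, map_sub, map_smul, map_sub]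
  module

/-- The Gronwall inequality for the error: the linear part costs `Q`, and the Taylor remainder costs
`η` times the difference quotient, itself at most the error plus `Z`. With `η ≤ 1` the rate is
uniform in `η`. -/
lemma norm_quotientError_deriv_le {h t η : ℝ} (hη : η ≤ 1) (hη0 : 0 ≤ η) {Q Z : ℝ}
    (hQ : ‖nonlinDeriv hd M (shiftC (-t) (v t))‖ ≤ Q) (hZ : ‖ζ t‖ ≤ Z)
    (hN : ‖contToL2 (nonlin hd.continuous M k (shiftC (-(t + h)) (v (t + h)))) -
        contToL2 (nonlin hd.continuous M k (shiftC (-t) (v t))) -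
        mulC (nonlinDeriv hd M (shiftC (-t) (v t)))
          (evenProj (movingToL2 v (t + h) - movingToL2 v t))‖
        ≤ η * ‖movingToL2 v (t + h) - movingToL2 v t‖) :
    ‖-shift t (h⁻¹ • (contToL2 (nonlin hd.continuous M k (shiftC (-(t + h)) (v (t + h)))) -
        contToL2 (nonlin hd.continuous M k (shiftC (-t) (v t)))) -
        mulC (nonlinDeriv hd M (shiftC (-t) (v t))) (evenProj (shift (-t) (ζ t))))‖
      ≤ (Q + 1) * ‖quotientError v ζ h t‖ + η * Z := by
  have hq := shift_neg_quotientError_add (v := v) (ζ := ζ) h t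
  set e := quotientError v ζ h t
  set δ := movingToL2 v (t + h) - movingToL2 v t
  set N := contToL2 (nonlin hd.continuous M k (shiftC (-(t + h)) (v (t + h)))) -
        contToL2 (nonlin hd.continuous M k (shiftC (-t) (v t)))
  set B := nonlinDeriv hd M (shiftC (-t) (v t))
  have e1 : h⁻¹ • N - mulC B (evenProj (shift (-t) (ζ t)))
      = h⁻¹ • (N - mulC B (evenProj δ)) + mulC B (evenProj (shift (-t) e)) := by
    have : mulC B (evenProj (shift (-t) e)) + mulC B (evenProj (shift (-t) (ζ t)))
        = h⁻¹ • mulC B (evenProj δ) := by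
      rw [← map_add, ← map_add, ← map_add, hq, map_smul, map_smul]
    rw [smul_sub h⁻¹ N, ← this]
    abel
  have hδ : ‖h⁻¹ • δ‖ ≤ ‖e‖ + Z := by
    rw [← hq, LinearIsometry.norm_map]
    exact (norm_add_le _ _).trans (by linarith)
  have h1 : ‖h⁻¹ • (N - mulC B (evenProj δ))‖ ≤ η * (‖e‖ + Z) := by
    rw [norm_smul] at hδ ⊢
    calc ‖h⁻¹‖ * ‖N - mulC B (evenProj δ)‖ ≤ ‖h⁻¹‖ * (η * ‖δ‖) := by gcongr
      _ = η * (‖h⁻¹‖ * ‖δ‖) := by ring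
      _ ≤ _ := by gcongr
  have h2 : ‖mulC B (evenProj (shift (-t) e))‖ ≤ Q * ‖e‖ := by
    refine (norm_mulC_le _ _).trans ?_
    have := norm_evenProj_le (shift (-t) e)
    rw [LinearIsometry.norm_map] at this
    have hQ0 : 0 ≤ Q := (norm_nonneg _).trans hQ
    gcongr
  rw [norm_neg, LinearIsometry.norm_map, e1]
  refine (norm_add_le _ _).trans ((add_le_add h1 h2).trans ?_)
  nlinarith [mul_le_mul_of_nonneg_right hη (norm_nonneg e)]

/-- The difference quotients of the solution converge to the solution of the linearised equation. -/
lemma tendsto_quotientError (hv : Continuous v) (hT : 0 ≤ T)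
    (hvd : ∀ t ∈ Icc 0 (T + 1), HasDerivAt v (nonlinShift hd.continuous M k t (v t)) t)
    (hu : IsDblDeriv (contToL2 (v 0)) u₀) (hζc : Continuous ζ)
    (hζ0 : ζ 0 = -u₀ - contToL2 (nonlin hd.continuous M k (v 0)))
    (hζ : ∀ t ∈ Icc 0 T, HasDerivAt ζ (-shift t (mulC (nonlinDeriv hd M (shiftC (-t) (v t)))
      (evenProj (shift (-t) (ζ t))))) t) {t : ℝ} (ht : t ∈ Icc 0 T) :
    Tendsto (fun h => quotientError v ζ h t) (𝓝[>] 0) (𝓝 0) := by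
  have hw := continuous_shiftC_neg hv
  obtain ⟨A, hA⟩ := (isCompact_Icc (a := (0 : ℝ)) (b := T)).exists_bound_of_continuousOn
    hw.continuousOn
  obtain ⟨Q, hQ⟩ := (isCompact_Icc (a := (0 : ℝ)) (b := T)).exists_bound_of_continuousOn
    ((continuous_nonlinDeriv hd M).comp hw).continuousOn
  obtain ⟨Z, hZ⟩ := (isCompact_Icc (a := (0 : ℝ)) (b := T)).exists_bound_of_continuousOn
    hζc.continuousOn
  have h0 : (0 : ℝ) ∈ Icc 0 T := ⟨le_rfl, hT⟩
  have hQ0 : 0 ≤ Q := (norm_nonneg _).trans (hQ 0 h0)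
  have hZ0 : 0 ≤ Z := (norm_nonneg _).trans (hZ 0 h0)
  have hQ1 : Q + 1 ≠ 0 := by positivity
  have hunif := isCompact_Icc.uniformContinuousOn_of_continuous (s := Icc 0 (T + 1))
    hw.continuousOn
  have key : ∀ η > 0, η ≤ 1 → ∀ᶠ h in 𝓝[>] (0 : ℝ), ‖quotientError v ζ h t‖
      ≤ gronwallBound ‖quotientError v ζ h 0‖ (Q + 1) (η * Z) t := by
    intro η hη hη1
    obtain ⟨δ, hδ, hN⟩ := exists_norm_nonlin_sub_le hd M k A hη
    obtain ⟨ε, hε, hU⟩ := Metric.uniformContinuousOn_iff_le.1 hunif δ hδ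
    filter_upwards [Ioc_mem_nhdsGT (show (0 : ℝ) < min ε 1 by positivity)] with h hh
    have hh0 : 0 < h := hh.1
    have hhε : h ≤ ε := hh.2.trans (min_le_left _ _)
    have hh1 : h ≤ 1 := hh.2.trans (min_le_right _ _)
    have hder : ∀ s ∈ Icc 0 T, HasDerivAt (quotientError v ζ h) _ s := fun s hs =>
      hasDerivAt_quotientError hd (h := h) (hvd s ⟨hs.1, by linarith [hs.2]⟩)
        (hvd (s + h) ⟨by linarith [hs.1], by linarith [hs.2]⟩) (hζ s hs)
    have := norm_le_gronwallBound_of_norm_deriv_right_le (a := 0) (b := T)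
      (δ := ‖quotientError v ζ h 0‖) (K := Q + 1) (ε := η * Z)
      (fun s hs => (hder s hs).continuousAt.continuousWithinAt)
      (fun s hs => (hder s (Ico_subset_Icc_self hs)).hasDerivWithinAt) le_rfl
      (fun s hs => by
        have hs' := Ico_subset_Icc_self hs
        refine norm_quotientError_deriv_le hd hη1 hη.le (hQ s hs') (hZ s hs') ?_
        refine hN _ _ (hA s hs') ?_
        rw [← dist_eq_norm]
        refine hU _ ⟨by linarith [hs.1], by linarith [hs.2]⟩ _ ⟨hs.1, by linarith [hs.2]⟩ ?_
        rw [Real.dist_eq, add_sub_cancel_left, abs_of_pos hh0]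
        exact hhε) t ht
    rwa [sub_zero] at this
  have hlim0 := (tendsto_quotientError_zero hd (hvd 0 ⟨le_rfl, by linarith⟩) hu hζ0).norm
  rw [norm_zero] at hlim0
  rw [tendsto_zero_iff_norm_tendsto_zero, Metric.tendsto_nhds]
  intro ε hε
  simp only [gronwallBound_of_K_ne_0 hQ1] at key
  set E := Real.exp ((Q + 1) * t)
  have hE1 : 1 ≤ E := Real.one_le_exp (mul_nonneg (by positivity) ht.1)
  set c := Z / (Q + 1) * (E - 1)
  have hc : 0 ≤ c := mul_nonneg (by positivity) (by linarith)
  -- This `η` keeps the forcing term of the Gronwall bound below `ε / 2`; the initial error takes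
  -- the other half.
  have hη : 0 < min 1 (ε / (2 * (c + 1))) := by positivity
  filter_upwards [key _ hη (min_le_left _ _),
    (tendsto_order.1 hlim0).2 (ε / (2 * E)) (by positivity)] with h h1 h2
  rw [Real.dist_eq, sub_zero, abs_of_nonneg (norm_nonneg _)]
  refine h1.trans_lt ?_
  have h3 : ‖quotientError v ζ h 0‖ * E < ε / 2 := by
    have := mul_lt_mul_of_pos_right h2 (show 0 < E by linarith)
    have e : ε / (2 * E) * E = ε / 2 := by field_simp
    linarith
  have h4 : min 1 (ε / (2 * (c + 1))) * Z / (Q + 1) * (E - 1) ≤ ε / 2 := by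
    have e1 : min 1 (ε / (2 * (c + 1))) * Z / (Q + 1) * (E - 1)
        = min 1 (ε / (2 * (c + 1))) * c := by simp only [c]; ring
    rw [e1]
    calc min 1 (ε / (2 * (c + 1))) * c ≤ ε / (2 * (c + 1)) * (c + 1) :=
          mul_le_mul (min_le_right _ _) (by linarith) hc (by positivity)
      _ = ε / 2 := by field_simp
  linarith

/-- If the initial value is weakly differentiable, the solution is `C¹` in time with values in
`L²`. -/
theorem exists_movingToL2_eq_integral (hv : Continuous v) (hT : 0 ≤ T)
    (hvd : ∀ t ∈ Icc 0 (T + 1), HasDerivAt v (nonlinShift hd.continuous M k t (v t)) t)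
    (hu : IsDblDeriv (contToL2 (v 0)) u₀) :
    ∃ z : ℝ → L2Dbl, Continuous z ∧
      ∀ t ∈ Icc 0 T, movingToL2 v t = movingToL2 v 0 + ∫ s in (0 : ℝ)..t, z s := by
  obtain ⟨ζ, hζc, hζ0, hζ⟩ := exists_hasDerivAt_linearized
    ((continuous_nonlinDeriv hd M).comp (continuous_shiftC_neg hv))
    (-u₀ - contToL2 (nonlin hd.continuous M k (v 0))) hT
  have hzc : Continuous fun t => shift (-t) (ζ t) :=
    continuous_shift.comp (continuous_neg.prodMk hζc)
  -- Only positive increments were controlled, but a continuous curve with continuous right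
  -- derivative is the integral of it.
  have hder : ∀ t ∈ Icc 0 T, HasDerivWithinAt (movingToL2 v) (shift (-t) (ζ t)) (Ioi t) t := by
    intro t ht
    rw [hasDerivWithinAt_iff_tendsto_slope' self_notMem_Ioi]
    have h1 := (tendsto_quotientError hd hv hT hvd hu hζc hζ0 hζ ht).add_const (ζ t)
    have h2 := ((shift (-t)).continuous.tendsto _).comp h1
    rw [zero_add] at h2
    have h3 : Tendsto (fun s => s - t) (𝓝[>] t) (𝓝[>] 0) := by
      refine tendsto_nhdsWithin_iff.2 ⟨?_, ?_⟩
      · have : Tendsto (fun s => s - t) (𝓝 t) (𝓝 (t - t)) :=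
          (continuous_id.sub continuous_const).tendsto t
        rw [sub_self] at this
        exact this.mono_left nhdsWithin_le_nhds
      · filter_upwards [self_mem_nhdsWithin] with s hs
        exact sub_pos.2 (mem_Ioi.1 hs)
    refine (h2.comp h3).congr fun s => ?_
    simp only [Function.comp]
    rw [shift_neg_quotientError_add, add_sub_cancel, slope_def_module]
  refine ⟨_, hzc, fun t ht => ?_⟩
  rw [intervalIntegral.integral_eq_sub_of_hasDeriv_right (continuous_movingToL2 hv).continuousOn
    (fun s hs => hder s ?_) (hzc.intervalIntegrable _ _)]
  · abel
  · rw [min_eq_left ht.1, max_eq_right ht.1] at hs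
    exact ⟨hs.1.le, hs.2.le.trans ht.2⟩

end Regularity

end TimeRegularity

/-! ### Spatial regularity, lifts of the data and existence -/

lemma hasDerivAt_integral_of_continuous {E : Type*} [NormedAddCommGroup E] [NormedSpace ℝ E]
    [CompleteSpace E] {z : ℝ → E} (hz : Continuous z) (t : ℝ) :
    HasDerivAt (fun t => ∫ s in (0 : ℝ)..t, z s) (z t) t :=
  intervalIntegral.integral_hasDerivAt_right (hz.intervalIntegrable _ _)
    (hz.stronglyMeasurableAtFilter _ _) hz.continuousAt

/-- The spatial weak derivative of the solution, expressed through the time derivative `z`. -/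
lemma inner_movingToL2_eq {d : ℝ → ℝ} (hd : Continuous d) {M : C(Dbl, ℝ)} {k T : ℝ}
    {v : ℝ → C(Dbl, ℝ)} (hT : 0 < T)
    (hvd : ∀ t ∈ Icc 0 T, HasDerivAt v (nonlinShift hd M k t (v t)) t)
    {z : ℝ → L2Dbl} (hz : Continuous z)
    (hzv : ∀ t ∈ Icc 0 T, movingToL2 v t = movingToL2 v 0 + ∫ s in (0 : ℝ)..t, z s)
    {t : ℝ} (ht : t ∈ Icc 0 T) (Φ Φ' : L2Dbl) (hΦ : IsDblDeriv Φ Φ') :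
    inner ℝ (movingToL2 v t) Φ'
      = -inner ℝ (-(z t + contToL2 (nonlin hd M k (shiftC (-t) (v t))))) Φ := by
  have h1 : HasDerivWithinAt (fun t => inner ℝ (movingToL2 v t) Φ) (inner ℝ (z t) Φ)
      (Icc 0 T) t := by
    have := (((hasDerivAt_integral_of_continuous hz t).const_add (movingToL2 v 0)).inner ℝ
      (hasDerivAt_const t Φ)).hasDerivWithinAt (s := Icc 0 T)
    rw [inner_zero_right, zero_add] at this
    exact this.congr (fun s hs => by rw [hzv s hs]) (by rw [hzv t ht])
  -- The same derivative computed in the moving frame, with the translation moved onto `Φ`.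
  -- Comparing both values gives the weak form of `∂ₓw = -(∂ₜw + N)`, with `N` the nonlinear term.
  have h2 : HasDerivWithinAt (fun t => inner ℝ (movingToL2 v t) Φ)
      (inner ℝ (movingToL2 v t) Φ' - inner ℝ (contToL2 (nonlin hd M k (shiftC (-t) (v t)))) Φ)
      (Icc 0 T) t := by
    have hV : HasDerivAt (fun t => contToL2 (v t)) _ t :=
      contToL2.hasFDerivAt.comp_hasDerivAt t (hvd t ht)
    have := (hV.inner ℝ (hΦ.hasDerivAt_shift t)).hasDerivWithinAt (s := Icc 0 T)
    rw [contToL2_nonlinShift, inner_neg_left, LinearIsometry.inner_map_map, ← sub_eq_add_neg] at this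
    have e : ∀ (s : ℝ) (Ψ : L2Dbl), inner ℝ (contToL2 (v s)) (shift s Ψ)
        = inner ℝ (movingToL2 v s) Ψ := fun s Ψ => by
      rw [movingToL2_eq, inner_shift_left, neg_neg]
    simp only [e] at this
    exact this
  have h3 := (uniqueDiffOn_Icc hT t ht).eq_deriv _ h1 h2
  rw [inner_neg_left, neg_neg, inner_add_left, h3]
  ring

/-- The element of `H¹(0,1)` given by a function and its weak derivative. -/
def H1.mk {u w : L2} (h : IsWeakDeriv u w) : H1 := ⟨WithLp.toLp 2 (u, w), h⟩

lemma H1.continuous_mk {X : Type*} [TopologicalSpace X] {u w : X → L2}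
    (h : ∀ x, IsWeakDeriv (u x) (w x)) (hu : Continuous u) (hw : Continuous w) :
    Continuous fun x => H1.mk (h x) :=
  ((WithLp.prod_continuous_toLp 2 L2 L2).comp (hu.prodMk hw)).subtype_mk _

lemma H1.fn_add (u v : H1) : (u + v).fn = u.fn + v.fn := rfl

lemma H1.dx_add (u v : H1) : (u + v).dx = u.dx + v.dx := rfl

lemma H1.fn_mk {u w : L2} (h : IsWeakDeriv u w) : (H1.mk h).fn = u := rfl

lemma H1.dx_mk {u w : L2} (h : IsWeakDeriv u w) : (H1.mk h).dx = w := rfl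

/-- The continuous function on the circle with odd part `c` and even part `e`. -/
lemma exists_dbl_odd_even {c e : ℝ → ℝ} (hc : ContinuousOn c (Icc 0 1))
    (he : ContinuousOn e (Icc 0 1)) (h0 : c 0 = 0) (h1 : c 1 = 0) :
    ∃ w : C(Dbl, ℝ), ∀ x ∈ Ioo (0 : ℝ) 1, w x = e x + c x ∧ w (-x : ℝ) = e x - c x := by
  -- On each side of 0 one of the two `c` terms is `c 0 = 0`, so this is the even extension of `e`
  -- plus the odd extension of `c`; `c 1 = 0` makes the values at -1 and 1 agree.
  have hF : ContinuousOn (fun x : ℝ => e |x| + c (max x 0) - c (max (-x) 0)) (Icc (-1) 1) := by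
    refine ((he.comp continuous_abs.continuousOn fun x hx => ?_).add
      (hc.comp (by fun_prop) fun x hx => ?_)).sub (hc.comp (by fun_prop) fun x hx => ?_)
    · exact ⟨abs_nonneg x, abs_le.2 hx⟩
    · exact ⟨le_max_right _ _, max_le hx.2 zero_le_one⟩
    · exact ⟨le_max_right _ _, max_le (by linarith [hx.1]) zero_le_one⟩
  obtain ⟨w, hw⟩ := exists_dbl_of_continuousOn hF (by simp [h0, h1])
  refine ⟨w, fun x hx => ⟨?_, ?_⟩⟩
  · rw [hw x ⟨by linarith [hx.1], hx.2⟩, abs_of_pos hx.1, max_eq_left hx.1.le,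
      max_eq_right (by linarith [hx.1]), h0, sub_zero]
  · rw [hw (-x) ⟨by linarith [hx.2], by linarith [hx.1]⟩, abs_neg, abs_of_pos hx.1, neg_neg,
      max_eq_left hx.1.le, max_eq_right (by linarith [hx.1]), h0, add_zero]

/-- Both end values prescribe the mean of the derivative, so `g` must be corrected by a constant
`k`; this constant reappears in the nonlinearity. -/
lemma exists_H1_lift (g : L2) (h : Fin 2 → ℝ) : ∃ (k : ℝ) (u : H1), u.HasBoundaryValues h ∧
    ∀ᵐ x ∂unitMeasure, u.dx x = g x - k := by
  set k := (∫ x in Ioo (0 : ℝ) 1, g x) - (h 1 - h 0)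
  set a : L2 := g - (memLp_const k).toLp _
  have ha : a =ᵐ[unitMeasure] fun x => g x - k := by
    filter_upwards [Lp.coeFn_sub g ((memLp_const k).toLp _),
      (memLp_const (p := 2) (μ := unitMeasure) k).coeFn_toLp] with x h1 h2
    rw [h1, Pi.sub_apply, h2]
  have hP := isPrimitive_integral a.intervalIntegrable (h 0)
  obtain ⟨u, hu, hPu⟩ := hP.exists_H1
  refine ⟨k, u, ⟨_, hP.continuousOn, hPu, by simp, ?_⟩, by rwa [hu]⟩
  have e : ∫ t in (0 : ℝ)..1, a t = h 1 - h 0 := by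
    rw [intervalIntegral.integral_of_le zero_le_one, integral_Ioc_eq_integral_Ioo,
      integral_congr_ae ha, integral_sub g.integrable (integrable_const k)]
    simp [k]
  rw [e]
  ring

lemma exists_H1_dx_eq (f : L2) : ∃ u : H1, u.dx = f := by
  obtain ⟨u, hu, -⟩ := (isPrimitive_integral f.intervalIntegrable 0).exists_H1
  exact ⟨u, hu⟩

lemma contDiffOn_add_clm {F : Type*} [NormedAddCommGroup F] [NormedSpace ℝ F] {T : ℝ} (hT : 0 < T)
    {z : ℝ → L2Dbl} (hz : Continuous z) {W : ℝ → L2Dbl} {W₀ : L2Dbl}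
    (hW : ∀ t ∈ Icc 0 T, W t = W₀ + ∫ s in (0 : ℝ)..t, z s) (A : L2Dbl →L[ℝ] F) (b : F)
    {q : ℝ → F} (hq : ∀ t ∈ Icc 0 T, q t = b + A (W t)) :
    ContDiffOn ℝ 1 q (Icc 0 T) ∧ ∀ t ∈ Icc 0 T, derivWithin q (Icc 0 T) t = A (z t) := by
  have hG : ∀ t, HasDerivAt (fun t => b + A (W₀ + ∫ s in (0 : ℝ)..t, z s)) (A (z t)) t := fun t =>
    (A.hasFDerivAt.comp_hasDerivAt t
      ((hasDerivAt_integral_of_continuous hz t).const_add W₀)).const_add b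
  have hqG : ∀ t ∈ Icc 0 T, q t = b + A (W₀ + ∫ s in (0 : ℝ)..t, z s) := fun t ht => by
    rw [hq t ht, hW t ht]
  constructor
  · refine ContDiffOn.congr (ContDiff.contDiffOn ?_) hqG
    refine contDiff_one_iff_deriv.2 ⟨fun t => (hG t).differentiableAt, ?_⟩
    rw [show deriv (fun t => b + A (W₀ + ∫ s in (0 : ℝ)..t, z s)) = fun t => A (z t) from
      funext fun t => (hG t).deriv]
    exact A.continuous.comp hz
  · intro t ht
    exact ((hG t).hasDerivWithinAt.congr hqG (hqG t ht)).derivWithin (uniqueDiffOn_Icc hT t ht)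

section Parts

variable {d : ℝ → ℝ} (hd : Continuous d) {M : C(Dbl, ℝ)} {k : ℝ} {μ : ℝ → ℝ}

/-- The nonlinearity depends only on even functions, hence is even and leaves the equation for `p`
undamped. -/
lemma oddPart_nonlin_eq_zero (hM : ∀ x ∈ Ioo (0 : ℝ) 1, M x = μ x ∧ M (-x : ℝ) = μ x)
    (w : C(Dbl, ℝ)) : oddPart (contToL2 (nonlin hd M k w)) = 0 := by
  refine Lp.ext ?_
  filter_upwards [coeFn_oddPart_contToL2 (nonlin hd M k w), Lp.coeFn_zero ℝ 2 unitMeasure,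
    ae_restrict_mem measurableSet_Ioo] with x h1 h2 hx
  rw [h1, h2, nonlin_apply, nonlin_apply, (hM x hx).1, (hM x hx).2, AddCircle.coe_neg, neg_neg,
    add_comm (w (-x)), sub_self, zero_div, Pi.zero_apply]

lemma coeFn_evenPart_nonlin (hM : ∀ x ∈ Ioo (0 : ℝ) 1, M x = μ x ∧ M (-x : ℝ) = μ x)
    (w : C(Dbl, ℝ)) : evenPart (contToL2 (nonlin hd M k w)) =ᵐ[unitMeasure]
      fun x => d (μ x + evenPart (contToL2 w) x) - k := by
  filter_upwards [coeFn_evenPart_contToL2 (nonlin hd M k w), coeFn_evenPart_contToL2 w,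
    ae_restrict_mem measurableSet_Ioo] with x h1 h2 hx
  rw [h1, h2, nonlin_apply, nonlin_apply, (hM x hx).1, (hM x hx).2, AddCircle.coe_neg, neg_neg,
    add_comm (w (-x))]
  ring

end Parts

lemma hasBoundaryValues_zero_of_fn_eq_oddPart {u : H1} {w : C(Dbl, ℝ)}
    (h : u.fn = oddPart (contToL2 w)) : u.HasBoundaryValues 0 := by
  refine ⟨fun x => (w x - w (-x : ℝ)) / 2, ?_, ?_, by simp, ?_⟩
  · have := continuous_coe_dbl
    exact Continuous.continuousOn (by fun_prop)
  · rw [h]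
    exact (coeFn_oddPart_contToL2 w).symm
  · simp only [coe_neg_one_dbl, sub_self, zero_div, Pi.zero_apply]

lemma H1.HasBoundaryValues.add_zero {u v : H1} {h : Fin 2 → ℝ} (hu : u.HasBoundaryValues h)
    (hv : v.HasBoundaryValues 0) : (u + v).HasBoundaryValues h := by
  obtain ⟨c, hc, hcu, h0, h1⟩ := hu
  obtain ⟨e, he, hev, e0, e1⟩ := hv
  refine ⟨c + e, hc.add he, ?_, by simp [h0, e0], by simp [h1, e1]⟩
  rw [H1.fn_add]
  exact (hcu.add hev).trans (Lp.coeFn_add _ _).symm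

/-- Odd and even parts of the transport equation are the two equations of the system, the lifts
supplying `f` and `g - k`. Compatibility of `p₀` makes the odd extension of its remainder continuous
and weakly differentiable on the circle. -/
theorem exists_isSolution {d : ℝ → ℝ} (hd : ContDiff ℝ 1 d) (hm : Monotone d) (f g : L2)
    (h : Fin 2 → ℝ) (p₀ m₀ : H1) (hcompat : p₀.HasBoundaryValues h) {T : ℝ} (hT : 0 < T) :
    ∃ p m : ℝ → H1, IsSolution d f g h p₀ m₀ T p m := by
  obtain ⟨k, uP, huP, hPdx⟩ := exists_H1_lift g h
  obtain ⟨uM, hMdx⟩ := exists_H1_dx_eq f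
  obtain ⟨μ, hμ, hμM⟩ := uM.exists_isPrimitive
  obtain ⟨M, hM⟩ := exists_dbl_odd_even (c := 0) continuousOn_const hμ.continuousOn rfl rfl
  simp only [Pi.zero_apply, add_zero, sub_zero] at hM
  obtain ⟨c, hc, hcp⟩ := (p₀ - uP).exists_isPrimitive
  obtain ⟨e, he, hem⟩ := (m₀ - uM).exists_isPrimitive
  have hcb := (hcompat.sub huP).eq_of_isPrimitive hc hcp
  rw [sub_self] at hcb
  obtain ⟨w₀, hw₀⟩ := exists_dbl_odd_even hc.continuousOn he.continuousOn hcb.1 hcb.2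
  have hodd : oddPart (contToL2 w₀) =ᵐ[unitMeasure] c := by
    filter_upwards [coeFn_oddPart_contToL2 w₀, ae_restrict_mem measurableSet_Ioo] with x h1 hx
    rw [h1, (hw₀ x hx).1, (hw₀ x hx).2]
    ring
  have heven : evenPart (contToL2 w₀) =ᵐ[unitMeasure] e := by
    filter_upwards [coeFn_evenPart_contToL2 w₀, ae_restrict_mem measurableSet_Ioo] with x h1 hx
    rw [h1, (hw₀ x hx).1, (hw₀ x hx).2]
    ring
  have hu₀ := isDblDeriv_of_isPrimitive hc he hcb.1 hcb.2 hodd heven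
  -- Solving up to `T + 1` leaves room for forward difference quotients with step at most 1 at every
  -- time in `[0, T]`.
  obtain ⟨v, hvc, hv0, hv⟩ := exists_hasDerivAt_nonlinShift hd hm M k w₀
    (show 0 ≤ T + 1 by linarith)
  rw [← hv0] at hu₀
  obtain ⟨z, hzc, hz⟩ := exists_movingToL2_eq_integral hd hvc hT.le hv hu₀
  set w : ℝ → C(Dbl, ℝ) := fun t => shiftC (-t) (v t) with hw
  have hwc : Continuous w := continuous_shiftC_neg hvc
  set N : ℝ → L2Dbl := fun t => contToL2 (nonlin hd.continuous M k (w t)) with hN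
  have hNc : Continuous N := contToL2.continuous.comp ((continuous_nonlin _ M k).comp hwc)
  set wx : ℝ → L2Dbl := fun t => -(z t + N t) with hwx
  have hwxc : Continuous wx := (hzc.add hNc).neg
  have hweak : ∀ t ∈ Icc 0 T, ∀ Φ Φ', IsDblDeriv Φ Φ' →
      inner ℝ (contToL2 (w t)) Φ' = -inner ℝ (wx t) Φ := fun t ht Φ Φ' hΦ =>
    inner_movingToL2_eq hd.continuous hT (fun s hs => hv s ⟨hs.1, by linarith [hs.2]⟩) hzc hz ht
      Φ Φ' hΦ
  -- Weak differentiability is known only on `[0, T]`; clamping time defines the `H¹` curves for all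
  -- real `t`.
  set τ : ℝ → ℝ := fun t => projIcc 0 T hT.le t with hτ
  have hτc : Continuous τ := continuous_subtype_val.comp continuous_projIcc
  have hτm : ∀ t, τ t ∈ Icc 0 T := fun t => (projIcc 0 T hT.le t).2
  have hτe : ∀ t ∈ Icc 0 T, τ t = t := fun t ht => by simp [hτ, projIcc_of_mem hT.le ht]
  have hwo : ∀ t, IsWeakDeriv (oddPart (contToL2 (w (τ t)))) (evenPart (wx (τ t))) := fun t =>
    isWeakDeriv_oddPart (hweak _ (hτm t))
  have hwe : ∀ t, IsWeakDeriv (evenPart (contToL2 (w (τ t)))) (oddPart (wx (τ t))) := fun t =>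
    isWeakDeriv_evenPart (hweak _ (hτm t))
  have hWc : Continuous fun t => contToL2 (w (τ t)) := contToL2.continuous.comp (hwc.comp hτc)
  set p : ℝ → H1 := fun t => uP + H1.mk (hwo t) with hp
  set m : ℝ → H1 := fun t => uM + H1.mk (hwe t) with hmdef
  have hpfn : ∀ t ∈ Icc 0 T, (p t).fn = uP.fn + oddPart (contToL2 (w t)) := fun t ht => by
    rw [hp, H1.fn_add, H1.fn_mk, hτe t ht]
  have hmfn : ∀ t ∈ Icc 0 T, (m t).fn = uM.fn + evenPart (contToL2 (w t)) := fun t ht => by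
    rw [hmdef, H1.fn_add, H1.fn_mk, hτe t ht]
  have hpdx : ∀ t ∈ Icc 0 T, (p t).dx = uP.dx + evenPart (wx t) := fun t ht => by
    rw [hp, H1.dx_add, H1.dx_mk, hτe t ht]
  have hmdx : ∀ t ∈ Icc 0 T, (m t).dx = f + oddPart (wx t) := fun t ht => by
    rw [hmdef, H1.dx_add, H1.dx_mk, hτe t ht, hMdx]
  have hDp := contDiffOn_add_clm hT hzc hz oddPart uP.fn hpfn
  have hDm := contDiffOn_add_clm hT hzc hz evenPart uM.fn hmfn
  have hw00 : w 0 = w₀ := by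
    ext x
    simp [hw, hv0]
  have h00 : (0 : ℝ) ∈ Icc 0 T := ⟨le_rfl, hT.le⟩
  refine ⟨p, m, ?_, ?_, hDp.1, hDm.1, ?_, ?_, ?_, ?_, ?_⟩
  · exact (continuous_const.add (H1.continuous_mk hwo (oddPart.continuous.comp hWc)
      (evenPart.continuous.comp (hwxc.comp hτc)))).continuousOn
  · exact (continuous_const.add (H1.continuous_mk hwe (evenPart.continuous.comp hWc)
      (oddPart.continuous.comp (hwxc.comp hτc)))).continuousOn
  · intro t ht
    have hsum : oddPart (z t) + (m t).dx = f := by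
      have hz0 : oddPart (N t) = 0 := oddPart_nonlin_eq_zero hd.continuous hM (w t)
      rw [hmdx t ht, hwx]
      simp only [map_neg, map_add, hz0]
      abel
    rw [hDp.2 t ht]
    filter_upwards [Lp.coeFn_add (oddPart (z t)) (m t).dx] with x hx
    rw [← Pi.add_apply, ← hx, hsum]
  · intro t ht
    have hsum : evenPart (z t) + (p t).dx = uP.dx - evenPart (N t) := by
      rw [hpdx t ht, hwx]
      simp only [map_neg, map_add]
      abel
    rw [hDm.2 t ht]
    filter_upwards [Lp.coeFn_add (evenPart (z t)) (p t).dx, Lp.coeFn_sub uP.dx (evenPart (N t)),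
      coeFn_evenPart_nonlin hd.continuous (k := k) hM (w t), hPdx, hμM,
      Lp.coeFn_add uM.fn (evenPart (contToL2 (w t)))] with x h1 h2 h3 h4 h5 h6
    rw [← Pi.add_apply, ← h1, hsum, h2, Pi.sub_apply, h3, h4, hmfn t ht, h6, Pi.add_apply, h5]
    ring
  · intro t ht
    exact huP.add_zero (hasBoundaryValues_zero_of_fn_eq_oddPart (w := w (τ t)) (H1.fn_mk _))
  · refine H1.ext_fn ?_
    rw [hpfn 0 h00, hw00, Lp.ext (hodd.trans hcp), H1.fn_sub]
    abel
  · refine H1.ext_fn ?_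
    rw [hmfn 0 h00, hw00, Lp.ext (heven.trans hem), H1.fn_sub]
    abel

end

theorem lemma3 (d : ℝ → ℝ) (hd : IsDamping d) (f g : L2) (h : Fin 2 → ℝ) (p₀ m₀ : H1)
    (hcompat : p₀.HasBoundaryValues h) (T : ℝ) (hT : 0 < T) :
    (∃ p m : ℝ → H1, IsSolution d f g h p₀ m₀ T p m) ∧
      ∀ p m p' m' : ℝ → H1, IsSolution d f g h p₀ m₀ T p m → IsSolution d f g h p₀ m₀ T p' m' →
        EqOn p p' (Icc 0 T) ∧ EqOn m m' (Icc 0 T) :=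
  ⟨exists_isSolution hd.1 hd.strictMono.monotone f g h p₀ m₀ hcompat hT,
    fun _ _ _ _ hs hs' => hs.eqOn hd.strictMono.monotone hT hs'⟩
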